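/- Let $p$ be a prime, $F$ a finite extension of $\mathbb{Q}_p$, and $\bar F$ an algebraic closure of $F$, endowed with the $p$-adic norm normalized by $\|p\| = p^{-[F:\mathbb{Q}_p]}$. For a finite extension $K$ of $F$ inside $\bar F$, let $\mathcal{O}_K$ be its ring of integers, $\lambda_K$ (written $dx$ in integrals) the Haar measure on $K$ with $\lambda_K(\mathcal{O}_K)=1$, and $D_K \in F$ the discriminant of $K/F$, i.e. the determinant of the trace form in an $\mathcal{O}_F$-basis of $\mathcal{O}_K$. Let $\Omega_n \simeq \mathcal{O}_F^{n+1}$ be the space of polynomials of degree at most $n$ over $\mathcal{O}_F$, with the probability measure $\lambda_F^{\otimes (n+1)}$ (written $dQ$ in integrals). For $U \subset K$ open, let $Z_{U,n}(P)$ be the number of (distinct) roots of $P \in \Omega_n$ lying in $U$, and $Z^{\mathrm{new}}_{U,n}(P)$ the number of those which lie in no strict subextension of $K/F$; the expectations below are for $P$ distributed according to the measure on $\Omega_n$. Then there is a family of measurable functions $\rho_{K,n} : K \to \mathbb{R}_{\geq 0}$, for $K$ running over the finite extensions of $F$ inside $\bar F$ and $n$ over the positive integers, such that, writing $r = [K:F]$: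 1. if $x \in \mathcal{O}_K$, $F[x] = K$ and $n \ge r$, then $$\rho_{K,n}(x) = \frac{\|D_K\|}{\#(\mathcal{O}_K/\mathcal{O}_F[x])} \int_{\Omega_{n-r}} \|Q(x)\|^r \, dQ;$$ if $x \in \mathcal{O}_K$ but $F[x]\neq K$ or $n<r$, then $\rho_{K,n}(x)=0$; and if $x \in K \setminus \mathcal{O}_K$, then $\rho_{K,n}(x) = \|x\|^{-2r} \rho_{K,n}(x^{-1})$; 2. for every open $U \subset K$, the functions $Z_{U,n}$ and $Z^{\mathrm{new}}_{U,n}$ are measurable with finite expectation, and $$\mathbb{E}[Z^{\mathrm{new}}_{U,n}] = \int_U \rho_{K,n}(x)\,dx, \qquad \mathbb{E}[Z_{U,n}] = \sum_{K' \subset K} \int_{U\cap K'} \rho_{K',n}(x)\,dx,$$ where the sum runs over all extensions $K'$ of $F$ included in $K$, and the integral over $U \cap K'$ is with respect to $\lambda_{K'}$. -/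

import Mathlib

set_option linter.style.haveILetI false

open MeasureTheory Polynomial
open scoped ENNReal NNReal

namespace PadicRoots

/-! Throughout, `F` is a finite extension of `ℚ_[p]` with its norm extending the `p`-adic norm of
`ℚ_[p]` (so `‖p‖ = 1/p`), and `E` is a normed field extension of `F` (in the end, a finite
extension of `F` inside an algebraic closure of `F`). -/

section NormAndIntegers

variable (p : ℕ) [Fact p.Prime] (F : Type*) [NormedField F] [NormedAlgebra ℚ_[p] F]

/-- The `p`-adic norm normalized by `‖p‖ = p ^ (-[F : ℚ_p])`. -/
noncomputable def pnorm {E : Type*} [NormedField E] (x : E) : ℝ :=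
  ‖x‖ ^ Module.finrank ℚ_[p] F

/-- The ring of integers `O_F` of `F`. -/
def intRing : Subring F where
  carrier := {x | ‖x‖ ≤ 1}
  mul_mem' {a b} ha hb := by
    simp only [Set.mem_ofPred_eq, norm_mul] at *
    exact mul_le_one₀ ha (norm_nonneg b) hb
  one_mem' := by simp
  zero_mem' := by simp
  add_mem' {a b} ha hb := by
    haveI : IsUltrametricDist F := IsUltrametricDist.of_normedAlgebra ℚ_[p]
    exact (IsUltrametricDist.norm_add_le_max a b).trans (max_le ha hb)
  neg_mem' {a} ha := by simpa using ha

/-- The ring of integers `O_E` of an extension `E` of `F`, as an `O_F`-algebra. -/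
def intAlg (E : Type*) [NormedField E] [NormedAlgebra F E] : Subalgebra (intRing p F) E where
  carrier := {x | ‖x‖ ≤ 1}
  mul_mem' {a b} ha hb := by
    simp only [Set.mem_ofPred_eq, norm_mul] at *
    exact mul_le_one₀ ha (norm_nonneg b) hb
  add_mem' {a b} ha hb := by
    haveI : IsUltrametricDist F := IsUltrametricDist.of_normedAlgebra ℚ_[p]
    haveI : IsUltrametricDist E := IsUltrametricDist.of_normedAlgebra F
    exact (IsUltrametricDist.norm_add_le_max a b).trans (max_le ha hb)
  algebraMap_mem' a := by
    change ‖algebraMap F E a‖ ≤ 1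
    rw [norm_algebraMap']
    exact a.2

end NormAndIntegers

section Finiteness

variable (p : ℕ) [Fact p.Prime] (F : Type*) [NormedField F] [NormedAlgebra ℚ_[p] F]
  [FiniteDimensional ℚ_[p] F]
  (E : Type*) [NormedField E] [NormedAlgebra F E] [FiniteDimensional F E]

theorem properSpace_base (p : ℕ) [Fact p.Prime] (F : Type*) [NormedField F] [NormedAlgebra ℚ_[p] F]
    [FiniteDimensional ℚ_[p] F] : ProperSpace F :=
  FiniteDimensional.proper ℚ_[p] F

/-- The field `F` as a nontrivially normed field (with the same norm). -/
abbrev nontriviallyNormed : NontriviallyNormedField F where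
  __ := ‹NormedField F›
  non_trivial := by
    obtain ⟨k, hk⟩ := NontriviallyNormedField.non_trivial (α := ℚ_[p])
    exact ⟨algebraMap ℚ_[p] F k, by simpa using hk⟩

theorem properSpace_ext (p : ℕ) [Fact p.Prime] (F : Type*) [NormedField F] [NormedAlgebra ℚ_[p] F]
    [FiniteDimensional ℚ_[p] F] (E : Type*) [NormedField E] [NormedAlgebra F E]
    [FiniteDimensional F E] : ProperSpace E := by
  haveI := properSpace_base p F
  letI := nontriviallyNormed p F
  exact FiniteDimensional.proper F E

theorem isPrincipalIdealRing_intRing : IsPrincipalIdealRing (intRing p F) := by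
  haveI := properSpace_base p F
  haveI : IsUltrametricDist F := IsUltrametricDist.of_normedAlgebra ℚ_[p]
  letI : Valued F ℝ≥0 := NormedField.toValued
  have h : Valued.integer F = intRing p F := by
    ext x
    change NormedField.valuation x ≤ 1 ↔ ‖x‖ ≤ 1
    exact Iff.rfl
  haveI : CompactSpace (Valued.integer F) := by
    refine isCompact_iff_compactSpace.mp (?_ : IsCompact ((Valued.integer F : Subring F) : Set F))
    rw [h]
    have : ((intRing p F : Subring F) : Set F) = Metric.closedBall 0 1 := by
      ext x
      simp [intRing]
    rw [this]
    exact isCompact_closedBall 0 1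
  rw [← h]
  exact Valued.integer.isPrincipalIdealRing_of_compactSpace

theorem finite_intAlg : Module.Finite (intRing p F) (intAlg p F E) := by
  haveI := properSpace_base p F
  haveI := properSpace_ext p F E
  letI := nontriviallyNormed p F
  haveI := isPrincipalIdealRing_intRing p F
  let e : E ≃L[F] (Fin (Module.finrank F E) → F) :=
    (Module.finBasis F E).equivFun.toContinuousLinearEquiv
  obtain ⟨C, hC⟩ := ((isCompact_closedBall (0 : E) 1).image e.continuous).isBounded.exists_norm_le
  obtain ⟨c, hc⟩ := NormedField.exists_lt_norm F (max C 0)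
  have hc0 : 0 < ‖c‖ := (le_max_right C 0).trans_lt hc
  have hb : ∀ x : intAlg p F E, ∀ i, c⁻¹ * e x i ∈ intRing p F := by
    intro x i
    have h1 : ‖e (x : E)‖ ≤ C := hC _ ⟨x, mem_closedBall_zero_iff.mpr x.2, rfl⟩
    have h2 : ‖e (x : E) i‖ ≤ ‖c‖ :=
      (norm_le_pi_norm _ i).trans (h1.trans ((le_max_left C 0).trans hc.le))
    change ‖c⁻¹ * e (x : E) i‖ ≤ 1
    rw [norm_mul, norm_inv, inv_mul_le_iff₀ hc0, mul_one]
    exact h2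
  let f : intAlg p F E →ₗ[intRing p F] (Fin (Module.finrank F E) → intRing p F) :=
    { toFun := fun x i => ⟨c⁻¹ * e x i, hb x i⟩
      map_add' := fun x y => by
        ext i
        simp [mul_add]
      map_smul' := fun a x => by
        ext i
        have : e ((a : F) • (x : E)) = (a : F) • e (x : E) := map_smul e _ _
        have h' : e (((a • x : intAlg p F E)) : E) i = (a : F) * e (x : E) i :=
          congrFun this i
        simp only [h', RingHom.id_apply, Pi.smul_apply, smul_eq_mul, Subring.coe_mul]
        ring }
  refine Module.Finite.of_injective f fun x y hxy => ?_
  apply Subtype.ext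
  apply e.injective
  ext i
  have h := congrArg Subtype.val (congrFun hxy i)
  exact mul_left_cancel₀ (inv_ne_zero (norm_pos_iff.mp hc0)) h

theorem free_intAlg : Module.Free (intRing p F) (intAlg p F E) := by
  haveI := isPrincipalIdealRing_intRing p F
  haveI := finite_intAlg p F E
  haveI : Module.IsTorsionFree (intRing p F) (intAlg p F E) := by
    refine Module.isTorsionFree_iff_smul_eq_zero.mpr fun a x h => ?_
    have h' : (a : F) • (x : E) = 0 := congrArg Subtype.val h
    rcases smul_eq_zero.mp h' with h'' | h''
    · exact Or.inl (Subtype.ext h'')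
    · exact Or.inr (Subtype.ext h'')
  infer_instance

/-- The discriminant `D_E` of `E / F`: the discriminant of the trace form of `E / F` on an
`O_F`-basis of `O_E`. It depends on the basis only up to the square of a unit of `O_F`. -/
noncomputable def discr : F :=
  haveI := finite_intAlg p F E
  haveI := free_intAlg p F E
  Algebra.discr F fun i : Module.Free.ChooseBasisIndex (intRing p F) (intAlg p F E) =>
    (Module.Free.chooseBasis (intRing p F) (intAlg p F E) i : E)

/-- The index `#(O_E / O_F[x])`, for `x` in `O_E`. -/
noncomputable def intIndex (x : E) : ℕ :=
  (Algebra.adjoin (intRing p F) {x}).toSubring.toAddSubgroup.relIndex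
    (intAlg p F E).toSubring.toAddSubgroup

end Finiteness

section Measures

variable (p : ℕ) [Fact p.Prime] (F : Type*) [NormedField F] [NormedAlgebra ℚ_[p] F]
  [FiniteDimensional ℚ_[p] F]

/-- The Haar measure `λ_E` on the additive group of `E`, normalized by `λ_E(O_E) = 1`. -/
noncomputable def haar (E : Type*) [NormedField E] [NormedAlgebra F E] [FiniteDimensional F E]
    [MeasurableSpace E] [BorelSpace E] : Measure E :=
  haveI := properSpace_ext p F E
  Measure.addHaarMeasure
    ⟨⟨Metric.closedBall (0 : E) 1, isCompact_closedBall 0 1⟩,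
      ⟨0, Metric.ball_subset_interior_closedBall (Metric.mem_ball_self one_pos)⟩⟩

/-- The space `Ω_n` of polynomials of degree at most `n` with coefficients in `O_F`, identified
with the space `O_F ^ (n + 1)` of their coefficients. -/
abbrev Omega (n : ℕ) : Type _ := Fin (n + 1) → intRing p F

/-- The polynomial over `F` whose coefficients are given by an element of `Ω_n`. -/
noncomputable def toPoly {n : ℕ} (P : Omega p F n) : F[X] :=
  ∑ i : Fin (n + 1), C (P i : F) * X ^ (i : ℕ)

/-- The probability measure on `Ω_n`: the product measure of the normalized Haar measures on the
coefficients. -/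
noncomputable def polyMeasure [MeasurableSpace F] [BorelSpace F] (n : ℕ) : Measure (Omega p F n) :=
  Measure.pi fun _ => (haar p F F).comap Subtype.val

end Measures

section Roots

variable (p : ℕ) [Fact p.Prime] {F : Type*} [NormedField F] [NormedAlgebra ℚ_[p] F]
  {Fbar : Type*} [NormedField Fbar] [NormedAlgebra F Fbar]

/-- `x` is new in `K`: it lies in `K` but in no strict subextension of `K / F`. -/
def IsNew (K : IntermediateField F Fbar) (x : Fbar) : Prop :=
  x ∈ K ∧ ∀ K' : IntermediateField F Fbar, K' < K → x ∉ K'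

/-- `Z_{U,n}`: the number (possibly `∞`) of roots in `U ⊆ K` of a polynomial in `Ω_n`. -/
noncomputable def Z {K : IntermediateField F Fbar} (U : Set K) (n : ℕ) (P : Omega p F n) : ℝ≥0∞ :=
  ({x : K | x ∈ U ∧ aeval x (toPoly p F P) = 0}.encard : ℝ≥0∞)

/-- `Z^new_{U,n}`: the number (possibly `∞`) of roots of a polynomial in `Ω_n` which lie in
`U ⊆ K` and are new in `K`. -/
noncomputable def Znew {K : IntermediateField F Fbar} (U : Set K) (n : ℕ) (P : Omega p F n) :
    ℝ≥0∞ :=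
  ({x : K | x ∈ U ∧ IsNew K (x : Fbar) ∧ aeval x (toPoly p F P) = 0}.encard : ℝ≥0∞)

/-- A subextension of a finite extension is finite. -/
instance finiteDimensional_sub {K : IntermediateField F Fbar} [FiniteDimensional F K]
    (K' : Set.Iic K) : FiniteDimensional F (K' : IntermediateField F Fbar) :=
  FiniteDimensional.of_injective (IntermediateField.inclusion K'.2).toLinearMap
    (IntermediateField.inclusion K'.2).injective

end Roots

end PadicRoots

open PadicRoots

set_option linter.unusedSectionVars false

/-! This is a `p`-adic Kac–Rice formula. Fix `E` of degree `r` over `F` and a set `U` of integral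
elements, stable under balls of radius `ε`. By Newton's method, the points `x ∈ U` with `‖P(x)‖ ≤
ε‖P'(x)‖` and `ε < ‖P'(x)‖` form a disjoint union of balls of radius `ε`, one around each root `ξ ∈
U` with `ε < ‖P'(ξ)‖` (`HasIntegralCoeffs.setOf_near_root_eq`). The number of these roots is thus a
quotient of Haar measures, and Tonelli turns its expectation into the integral over `U` of the
normalized probability `rootDensity` that `x` satisfies the two inequalities
(`lintegral_encard_eq_rootDensity`).

To compute this probability when `x` generates `E`, divide `P = A + ZQ` by the minimal polynomial
`Z` of `x` over `O_F`. The pair `(A, Q)` is again uniform, `P(x) = A(x)` is uniform in `O_F[x]`, and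
`P'(x) = A'(x) + Z'(x)Q(x)`. When `A(x)` is small so is `A'(x)`, because `A ↦ A'(x)` factors
linearly through `A(x)`; hence for small `ε` only `w = Z'(x)Q(x)` matters, and the condition becomes
`‖A(x)‖ ≤ ε‖w‖`. Haar measure scales by `pnorm w ^ r`, so the limit is the index of `O_F[x]` times
the mean of `pnorm w ^ r` (`tendsto_rootDensity`). Comparing the discriminant of the powers of `x`,
equal to `±N(Z'(x))`, with that of `O_E` gives the stated constant (`intIndex_mul_pow`).

As `ε → 0`, all roots are eventually counted because almost every polynomial has only simple roots
(`ae_simple_roots`). The densities are dominated where the discriminant of the powers of `x` is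
bounded below (`lintegral_rootCount_of_stable`), and an exhaustion treats all integral generators.
Reversing coefficients preserves the distribution and exchanges `x` with `x⁻¹`, which handles
non-integral roots through the change of variables `lintegral_haar_inv`. Finally, a root `x` is new
exactly in `F(x)`, so summing over the subextensions counts all roots (`Z_eq_tsum`). -/

namespace PadicRoots

open scoped Pointwise

/-! ### Linear maps and product Haar measures. -/

section LinearMaps

variable {k : Type*} [NormedField k] [SecondCountableTopology k] [MeasurableSpace k] [BorelSpace k]
  {ι : Type*} [Fintype ι] [DecidableEq ι] {μ : Measure k} [SigmaFinite μ]

theorem measurable_toLin' (M : Matrix ι ι k) : Measurable (Matrix.toLin' M) :=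
  (LinearMap.continuous_on_pi _).measurable

theorem map_diagonal_pi {c : k → ℝ≥0∞} (h1 : c 1 = 1) (hmul : ∀ a b, c (a * b) = c a * c b)
    (hc : ∀ a ≠ 0, μ.map (a * ·) = c a • μ) {D : ι → k} (hD : (Matrix.diagonal D).det ≠ 0) :
    (Measure.pi fun _ : ι => μ).map (Matrix.toLin' (Matrix.diagonal D)) =
      c (Matrix.diagonal D).det • Measure.pi fun _ : ι => μ := by
  have hD' : ∀ i, D i ≠ 0 := by
    intro i
    rw [Matrix.det_diagonal] at hD
    exact Finset.prod_ne_zero_iff.1 hD i (Finset.mem_univ i)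
  have hprod : c (Matrix.diagonal D).det = ∏ i, c (D i) := by
    rw [Matrix.det_diagonal]
    exact map_prod (⟨⟨c, h1⟩, hmul⟩ : k →* ℝ≥0∞) D Finset.univ
  have hσ : ∀ i, SigmaFinite (μ.map (D i * ·)) := fun i =>
    (Homeomorph.mulLeft₀ (D i) (hD' i)).toMeasurableEquiv.sigmaFinite_map
  have hfun : (Matrix.toLin' (Matrix.diagonal D) : (ι → k) → ι → k) = fun x i => D i * x i := by
    ext x i
    simp [Matrix.mulVec_diagonal]
  rw [hfun, Measure.pi_map_pi (μ := fun _ => μ) (f := fun i x => D i * x)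
    (fun i => (measurable_const_mul (D i)).aemeasurable)]
  refine Measure.pi_eq fun s hs => ?_
  simp only [hc _ (hD' _), Measure.smul_apply, smul_eq_mul, Measure.pi_pi, hprod]
  rw [Finset.prod_mul_distrib]

/-- Integrate first in the coordinate `t.i`: the shear translates it by a quantity that depends only
on the other coordinates. -/
theorem map_transvection_pi [μ.IsAddRightInvariant] (t : Matrix.TransvectionStruct ι k) :
    (Measure.pi fun _ : ι => μ).map (Matrix.toLin' t.toMatrix) = Measure.pi fun _ : ι => μ := by
  have ht : Measurable (Matrix.toLin' t.toMatrix) := measurable_toLin' _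
  refine (Measure.pi_eq fun s hs ↦ ?_).symm
  have h2s : MeasurableSet (Set.univ.pi s) := .pi Set.countable_univ fun i _ ↦ hs i
  simp_rw [← Measure.pi_pi, ← lintegral_indicator_one h2s]
  rw [lintegral_map (measurable_one.indicator h2s) ht]
  refine lintegral_eq_of_lmarginal_eq {t.i} ((measurable_one.indicator h2s).comp ht)
    (measurable_one.indicator h2s) ?_
  simp_rw [lmarginal_singleton]
  ext x
  cases t with | mk t_i t_j t_hij t_c =>
  simp [Matrix.transvection, Matrix.single_mulVec, t_hij.symm, ← Function.update_add,
    lintegral_add_right_eq_self fun xᵢ ↦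
      Set.indicator (Set.univ.pi s) 1 (Function.update x t_i xᵢ)]

theorem map_toLin'_pi [μ.IsAddRightInvariant] {c : k → ℝ≥0∞} (h1 : c 1 = 1)
    (hmul : ∀ a b, c (a * b) = c a * c b) (hc : ∀ a ≠ 0, μ.map (a * ·) = c a • μ)
    {M : Matrix ι ι k} (hM : M.det ≠ 0) :
    (Measure.pi fun _ : ι => μ).map (Matrix.toLin' M) = c M.det • Measure.pi fun _ : ι => μ := by
  apply Matrix.diagonal_transvection_induction_of_det_ne_zero _ M hM
  · exact fun D hD => map_diagonal_pi h1 hmul hc hD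
  · intro t
    rw [map_transvection_pi, Matrix.TransvectionStruct.det, h1, one_smul]
  · intro A B _ _ hA hB
    rw [Matrix.toLin'_mul, Matrix.det_mul, LinearMap.coe_comp,
      ← Measure.map_map (measurable_toLin' _) (measurable_toLin' _), hB, Measure.map_smul, hA,
      smul_smul, hmul, mul_comm]

end LinearMaps

/-- In coordinates `ν` becomes a multiple of the product measure, and the multiple cancels. Keeping
`c` abstract allows two uses: over `ℚ_[p]` to scale on `F`, then over `F` to scale on `E`. -/
theorem map_linearMap_haar {k : Type*} [NontriviallyNormedField k] [ProperSpace k]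
    [MeasurableSpace k] [BorelSpace k] (μ : Measure k) [μ.IsAddHaarMeasure]
    {c : k → ℝ≥0∞} (h1 : c 1 = 1) (hmul : ∀ a b, c (a * b) = c a * c b)
    (hc : ∀ a ≠ 0, μ.map (a * ·) = c a • μ)
    {E : Type*} [NormedAddCommGroup E] [NormedSpace k E] [FiniteDimensional k E]
    [MeasurableSpace E] [BorelSpace E] (ν : Measure E) [ν.IsAddHaarMeasure]
    (T : E →ₗ[k] E) (hT : LinearMap.det T ≠ 0) : ν.map T = c (LinearMap.det T) • ν := by
  classical
  let b := Module.finBasis k E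
  let e : E ≃L[k] (Fin (Module.finrank k E) → k) := b.equivFun.toContinuousLinearEquiv
  have hE : ProperSpace E := FiniteDimensional.proper k E
  have he : Measurable e := e.continuous.measurable
  have hes : Measurable e.symm := e.symm.continuous.measurable
  have hTm : Measurable T := (LinearMap.continuous_of_finiteDimensional T).measurable
  have hH : (ν.map e).IsAddHaarMeasure := e.isAddHaarMeasure_map ν
  obtain ⟨C, hC⟩ : ∃ C : ℝ≥0, ν.map e = C • Measure.pi fun _ => μ :=
    ⟨_, Measure.isAddLeftInvariant_eq_smul _ _⟩
  have hm : ∀ x, e (T x) = Matrix.toLin' (LinearMap.toMatrix b b T) (e x) := by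
    intro x
    exact (LinearMap.toMatrix_mulVec_repr b b T x).symm
  have hdet : (LinearMap.toMatrix b b T).det = LinearMap.det T := LinearMap.det_toMatrix b T
  have h2 : (ν.map T).map e = (c (LinearMap.det T) • ν).map e := by
    rw [Measure.map_map he hTm]
    have : (e ∘ T : E → _) = Matrix.toLin' (LinearMap.toMatrix b b T) ∘ e := funext hm
    rw [this, ← Measure.map_map (measurable_toLin' _) he, hC, Measure.map_smul, Measure.map_smul,
      map_toLin'_pi h1 hmul hc (by rwa [hdet]), hdet, hC, smul_comm]
  have h3 := congrArg (Measure.map e.symm) h2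
  rw [Measure.map_map hes he, Measure.map_map hes he] at h3
  simpa using h3

/-! ### Scaling of Haar measure on the `p`-adic numbers. -/

section Padic

variable (p : ℕ) [Fact p.Prime] [MeasurableSpace ℚ_[p]] [BorelSpace ℚ_[p]]

theorem closedBall_eq_iUnion_padic : Metric.closedBall (0 : ℚ_[p]) 1 =
    ⋃ i ∈ Finset.range p, (fun x : ℚ_[p] => (i : ℚ_[p]) + x) '' ((fun x => (p : ℚ_[p]) * x) ''
      Metric.closedBall (0 : ℚ_[p]) 1) := by
  have hp := (Fact.out : p.Prime)
  have hp0 : (p : ℚ_[p]) ≠ 0 := by exact_mod_cast hp.ne_zero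
  ext x
  simp only [Metric.mem_closedBall, dist_zero_right, Set.mem_iUnion, Set.mem_image,
    exists_exists_and_eq_and, exists_prop, Finset.mem_range]
  constructor
  · intro hx
    obtain ⟨n, hn, hn'⟩ := PadicInt.exists_mem_range (⟨x, hx⟩ : ℤ_[p])
    rw [PadicInt.maximalIdeal_eq_span_p, Ideal.mem_span_singleton] at hn'
    obtain ⟨y, hy⟩ := hn'
    refine ⟨n, hn, y, y.2, ?_⟩
    have := congrArg (Subtype.val : ℤ_[p] → ℚ_[p]) hy
    have h2 : x - n = p * y := this
    rw [← h2]
    ring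
  · rintro ⟨i, -, y, hy, rfl⟩
    refine (IsUltrametricDist.norm_add_le_max _ _).trans (max_le ?_ ?_)
    · exact_mod_cast Padic.norm_int_le_one (p := p) i
    · rw [norm_mul]
      exact mul_le_one₀ (by exact_mod_cast Padic.norm_int_le_one (p := p) p) (norm_nonneg _) hy

/-- The `p` residue classes modulo `p` partition the integers into translates of the same set, which
share its measure. -/
theorem measure_p_smul_padic (μ : Measure ℚ_[p]) [μ.IsAddHaarMeasure] :
    (p : ℝ≥0∞) * μ ((fun x => (p : ℚ_[p]) * x) '' Metric.closedBall (0 : ℚ_[p]) 1) =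
      μ (Metric.closedBall 0 1) := by
  have hp := (Fact.out : p.Prime)
  have hp0 : (p : ℚ_[p]) ≠ 0 := by exact_mod_cast hp.ne_zero
  have hmeas : ∀ i : ℕ, MeasurableSet ((fun x : ℚ_[p] => (i : ℚ_[p]) + x) ''
      ((fun x => (p : ℚ_[p]) * x) '' Metric.closedBall (0 : ℚ_[p]) 1)) := fun i =>
    (((isCompact_closedBall _ _).image (continuous_const_mul _)).image
      (continuous_const_add _)).measurableSet
  have hdisj : (Finset.range p : Set ℕ).PairwiseDisjoint fun i : ℕ =>
      (fun x : ℚ_[p] => (i : ℚ_[p]) + x) ''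
        ((fun x => (p : ℚ_[p]) * x) '' Metric.closedBall (0 : ℚ_[p]) 1) := by
    intro i hi j hj hij
    refine Set.disjoint_left.2 ?_
    rintro _ ⟨_, ⟨y, hy, rfl⟩, rfl⟩ ⟨_, ⟨z, hz, rfl⟩, h⟩
    simp only [mem_closedBall_zero_iff] at hy hz
    have h1 : (((i : ℤ) - j : ℤ) : ℚ_[p]) = p * (z - y) := by
      push_cast
      linear_combination -h
    have h2 : ‖(((i : ℤ) - j : ℤ) : ℚ_[p])‖ < 1 := by
      rw [h1, norm_mul]
      have : ‖z - y‖ ≤ 1 := by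
        rw [sub_eq_add_neg]
        exact (IsUltrametricDist.norm_add_le_max _ _).trans (max_le hz (by simpa using hy))
      exact mul_lt_one_of_nonneg_of_lt_one_left (norm_nonneg _) (by
        rw [Padic.norm_p]
        exact inv_lt_one_of_one_lt₀ (by exact_mod_cast hp.one_lt)) this
    rw [Padic.norm_intCast_lt_one_iff] at h2
    simp only [Finset.coe_range, Set.mem_Iio] at hi hj
    refine hij ?_
    have h3 : (i : ℤ) % p = j % p := Int.emod_eq_emod_iff_emod_sub_eq_zero.2
      (Int.emod_eq_zero_of_dvd h2)
    rw [Int.emod_eq_of_lt (by omega) (by omega), Int.emod_eq_of_lt (by omega) (by omega)] at h3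
    exact_mod_cast h3
  conv_rhs => rw [closedBall_eq_iUnion_padic p]
  rw [measure_biUnion_finset hdisj fun i _ => hmeas i]
  simp only [Set.image_add_left, measure_preimage_add, Finset.sum_const, Finset.card_range,
    nsmul_eq_mul]

/-- Units preserve the unit ball, so the character is trivial on them; at `p` its value follows from
the partition into residue classes. A general `a` is a unit times a power of `p`. -/
theorem distribHaarChar_padic (a : ℚ_[p]ˣ) : distribHaarChar ℚ_[p] a = ‖(a : ℚ_[p])‖₊ := by
  have hp := (Fact.out : p.Prime)
  have hp0 : (p : ℚ_[p]) ≠ 0 := by exact_mod_cast hp.ne_zero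
  let μ : Measure ℚ_[p] := Measure.addHaar
  have hb0 : μ (Metric.closedBall 0 1) ≠ 0 :=
    (Metric.measure_closedBall_pos μ _ one_pos).ne'
  have hb1 : μ (Metric.closedBall 0 1) ≠ ∞ := (isCompact_closedBall _ _).measure_lt_top.ne
  have hunit : ∀ u : ℚ_[p]ˣ, ‖(u : ℚ_[p])‖ = 1 → distribHaarChar ℚ_[p] u = 1 := by
    intro u hu
    refine distribHaarChar_eq_of_measure_smul_eq_mul hb0 hb1 ?_
    have : u • Metric.closedBall (0 : ℚ_[p]) 1 = Metric.closedBall 0 1 := by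
      ext x
      rw [Set.mem_smul_set_iff_inv_smul_mem, Units.smul_def]
      simp [hu]
    rw [this]
    simp
  let π : ℚ_[p]ˣ := Units.mk0 (p : ℚ_[p]) hp0
  have hπ : distribHaarChar ℚ_[p] π = ‖(p : ℚ_[p])‖₊ := by
    refine distribHaarChar_eq_of_measure_smul_eq_mul hb0 hb1 ?_
    rw [← measure_p_smul_padic p μ, ← mul_assoc]
    have h1 : ((‖(p : ℚ_[p])‖₊ : ℝ≥0) : ℝ≥0∞) * p = 1 := by
      have : (‖(p : ℚ_[p])‖₊ : ℝ≥0) * p = 1 := by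
        ext
        push_cast
        rw [Padic.norm_p]
        exact inv_mul_cancel₀ (by exact_mod_cast hp.ne_zero)
      exact_mod_cast this
    rw [h1, one_mul]
    rfl
  have hav : ‖(a : ℚ_[p])‖ = ‖(p : ℚ_[p])‖ ^ (a : ℚ_[p]).valuation := by
    rw [Padic.norm_eq_zpow_neg_valuation a.ne_zero, Padic.norm_p, inv_zpow, zpow_neg]
  generalize (a : ℚ_[p]).valuation = v at hav
  have hau : distribHaarChar ℚ_[p] (a * (π ^ v)⁻¹) = 1 := by
    refine hunit _ ?_
    push_cast
    rw [norm_mul, norm_inv, norm_zpow, hav]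
    exact mul_inv_cancel₀ (zpow_ne_zero _ (norm_ne_zero_iff.2 hp0))
  rw [map_mul, map_inv, map_zpow, hπ] at hau
  have hne : (‖(p : ℚ_[p])‖₊ : ℝ≥0) ^ v ≠ 0 := zpow_ne_zero _ (nnnorm_ne_zero_iff.2 hp0)
  rw [← div_eq_mul_inv, div_eq_one_iff_eq hne] at hau
  rw [hau]
  ext
  push_cast
  rw [hav]

/-- The pushforward evaluates the measure of `a⁻¹ • s`, whence the inverse of the norm here and in
the later scaling lemmas. -/
theorem map_mul_padic (μ : Measure ℚ_[p]) [μ.IsAddHaarMeasure] (a : ℚ_[p]) (ha : a ≠ 0) :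
    μ.map (a * ·) = ENNReal.ofReal ‖a‖⁻¹ • μ := by
  ext s hs
  have h := distribHaarChar_mul μ (Units.mk0 a ha)⁻¹ s
  rw [distribHaarChar_padic] at h
  rw [Measure.map_apply (measurable_const_mul a) hs, Measure.smul_apply, smul_eq_mul]
  have h2 : (fun x => a * x) ⁻¹' s = (Units.mk0 a ha)⁻¹ • s := by
    ext x
    rw [Set.mem_smul_set_iff_inv_smul_mem, inv_inv, Units.smul_def]
    rfl
  rw [h2, ← h, ← norm_inv]
  congr 1
  rw [ofReal_norm]
  rfl

end Padic

/-! ### Norms of elements and the scaling of Haar measure on extensions. -/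

theorem norm_algebraNorm {k : Type*} [NontriviallyNormedField k] [CompleteSpace k]
    [IsUltrametricDist k] [CharZero k] {L : Type*} [NormedField L] [NormedAlgebra k L]
    [FiniteDimensional k L] (x : L) : ‖Algebra.norm k x‖ = ‖x‖ ^ Module.finrank k L := by
  have hx : IsIntegral k x := Algebra.IsIntegral.isIntegral x
  -- The norm of `L` is the spectral norm, which is read off the constant coefficient of the minimal
  -- polynomial. Up to sign that coefficient is the norm of `x` from `k(x)`, and passing from `k(x)`
  -- to `L` raises it to the power `[L : k(x)]`.
  have h1 : ‖x‖ ^ (minpoly k x).natDegree = ‖(minpoly k x).coeff 0‖ := by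
    rw [NormedAlgebra.norm_eq_spectralNorm k x, spectralNorm.spectralNorm_eq_norm_coeff_zero_rpow, one_div,
      Real.rpow_inv_natCast_pow (norm_nonneg _) (minpoly.natDegree_pos hx).ne']
  have h2 := Algebra.PowerBasis.norm_gen_eq_coeff_zero_minpoly (IntermediateField.adjoin.powerBasis hx)
  rw [IntermediateField.adjoin.powerBasis_gen, IntermediateField.minpoly_gen] at h2
  rw [Algebra.norm_eq_norm_adjoin, h2, norm_pow, norm_mul, norm_pow, norm_neg, norm_one, one_pow,
    one_mul, ← h1, ← pow_mul, ← IntermediateField.adjoin.finrank hx,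
    Module.finrank_mul_finrank k]

theorem charZero_base (p : ℕ) [Fact p.Prime] (F : Type*) [NormedField F] [NormedAlgebra ℚ_[p] F] :
    CharZero F :=
  charZero_of_injective_algebraMap (algebraMap ℚ_[p] F).injective

section PNorm

variable (p : ℕ) [Fact p.Prime] {F : Type*} [NormedField F] [NormedAlgebra ℚ_[p] F]

theorem pnorm_mul {E : Type*} [NormedField E] (x y : E) :
    pnorm p F (x * y) = pnorm p F x * pnorm p F y := by
  simp [pnorm, mul_pow]

theorem pnorm_pos {E : Type*} [NormedField E] {x : E} (hx : x ≠ 0) : 0 < pnorm p F x :=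
  pow_pos (norm_pos_iff.2 hx) _

theorem pnorm_nonneg {E : Type*} [NormedField E] (x : E) : 0 ≤ pnorm p F x :=
  pow_nonneg (norm_nonneg _) _

theorem pnorm_algebraNorm [FiniteDimensional ℚ_[p] F] {E : Type*} [NormedField E]
    [NormedAlgebra F E] [FiniteDimensional F E] (y : E) :
    pnorm p F (Algebra.norm F y) = pnorm p F y ^ Module.finrank F E := by
  haveI := properSpace_base p F
  letI := nontriviallyNormed p F
  haveI := charZero_base p F
  haveI : IsUltrametricDist F := IsUltrametricDist.of_normedAlgebra ℚ_[p]
  rw [pnorm, norm_algebraNorm, pnorm, pow_right_comm]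

end PNorm

section Scaling

variable (p : ℕ) [Fact p.Prime] (F : Type*) [NormedField F] [NormedAlgebra ℚ_[p] F]
  [FiniteDimensional ℚ_[p] F]
  (E : Type*) [NormedField E] [NormedAlgebra F E] [FiniteDimensional F E]
  [MeasurableSpace E] [BorelSpace E]

instance isAddHaarMeasure_haar : (haar p F E).IsAddHaarMeasure := by
  haveI := properSpace_ext p F E
  unfold haar
  infer_instance

theorem haar_closedBall_one : haar p F E (Metric.closedBall 0 1) = 1 := by
  haveI := properSpace_ext p F E
  exact Measure.addHaarMeasure_self

theorem sigmaFinite_haar : SigmaFinite (haar p F E) := by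
  haveI := properSpace_ext p F E
  infer_instance

/-- Multiplication by `a` is `ℚ_[p]`-linear of determinant `N(a)`, and `‖N(a)‖ = ‖a‖ ^ [F : ℚ_p]`.
This is why the normalization of `pnorm` is the one that measures volumes in `F`. -/
theorem map_mul_haar_base [MeasurableSpace F] [BorelSpace F] (a : F) (ha : a ≠ 0) :
    (haar p F F).map (a * ·) = ENNReal.ofReal (pnorm p F a)⁻¹ • haar p F F := by
  haveI := properSpace_base p F
  borelize ℚ_[p]
  have hN : LinearMap.det (LinearMap.mulLeft ℚ_[p] a) = Algebra.norm ℚ_[p] a := rfl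
  have h := map_linearMap_haar (k := ℚ_[p]) Measure.addHaar
    (c := fun a => ENNReal.ofReal ‖a‖⁻¹) (by simp)
    (fun a b => by rw [norm_mul, mul_inv, ENNReal.ofReal_mul (by positivity)])
    (map_mul_padic p _) (haar p F F) (LinearMap.mulLeft ℚ_[p] a)
    (by rw [hN]; exact Algebra.norm_ne_zero_iff.2 ha)
  rw [hN, norm_algebraNorm] at h
  exact h

variable {E} in
theorem map_linearMap_haar_ext (T : E →ₗ[F] E) (hT : LinearMap.det T ≠ 0) :
    (haar p F E).map T = ENNReal.ofReal (pnorm p F (LinearMap.det T))⁻¹ • haar p F E := by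
  haveI := properSpace_base p F
  letI := nontriviallyNormed p F
  borelize F
  exact map_linearMap_haar (k := F) (haar p F F)
    (c := fun a => ENNReal.ofReal (pnorm p F a)⁻¹) (by simp [pnorm])
    (fun a b => by
      rw [pnorm_mul, mul_inv, ENNReal.ofReal_mul (inv_nonneg.2 (pnorm_nonneg p a))])
    (map_mul_haar_base p F) (haar p F E) T hT

variable {E} in
theorem map_mul_haar (y : E) (hy : y ≠ 0) :
    (haar p F E).map (y * ·) =
      ENNReal.ofReal (pnorm p F y ^ Module.finrank F E)⁻¹ • haar p F E := by
  have hN : LinearMap.det (LinearMap.mulLeft F y) = Algebra.norm F y := rfl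
  have h := map_linearMap_haar_ext p F (LinearMap.mulLeft F y)
    (by rw [hN]; exact Algebra.norm_ne_zero_iff.2 hy)
  rw [hN, pnorm_algebraNorm] at h
  exact h

variable {E} in
theorem haar_closedBall_mul (y : E) (hy : y ≠ 0) (ε : ℝ) :
    haar p F E (Metric.closedBall 0 (‖y‖ * ε)) =
      ENNReal.ofReal (pnorm p F y ^ Module.finrank F E) * haar p F E (Metric.closedBall 0 ε) := by
  have h := congrArg (fun ν : Measure E => ν (Metric.closedBall 0 (‖y‖ * ε)))
    (map_mul_haar p F y hy)
  have hpos : 0 < pnorm p F y ^ Module.finrank F E := pow_pos (pnorm_pos p hy) _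
  have h2 : (fun x => y * x) ⁻¹' Metric.closedBall 0 (‖y‖ * ε) = Metric.closedBall 0 ε := by
    ext x
    simp [mul_le_mul_iff_right₀ (norm_pos_iff.2 hy)]
  simp only [Measure.smul_apply, smul_eq_mul] at h
  rw [Measure.map_apply (measurable_const_mul y) measurableSet_closedBall, h2] at h
  rw [h, ← mul_assoc, ← ENNReal.ofReal_mul hpos.le, mul_inv_cancel₀ hpos.ne', ENNReal.ofReal_one,
    one_mul]

end Scaling

/-- The polynomial with a given tuple of coefficients. -/
noncomputable def polyOf {R : Type*} [CommRing R] {m : ℕ} (a : Fin m → R) : R[X] :=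
  ∑ i : Fin m, C (a i) * X ^ (i : ℕ)

/-! ### Coefficient tuples and Euclidean division. -/

section PolyOf

variable {R : Type*} [CommRing R] {m : ℕ}

theorem coeff_polyOf (a : Fin m → R) (j : ℕ) :
    (polyOf a).coeff j = if h : j < m then a ⟨j, h⟩ else 0 := by
  simp only [polyOf, finsetSum_coeff, coeff_C_mul, coeff_X_pow]
  split_ifs with h
  · rw [Finset.sum_eq_single ⟨j, h⟩]
    · simp
    · intro b _ hb
      rw [if_neg (fun h' => hb (Fin.ext h'.symm)), mul_zero]
    · simp
  · refine Finset.sum_eq_zero fun b _ => ?_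
    rw [if_neg (fun h' : j = b => h (h'.symm ▸ b.2)), mul_zero]

@[simp]
theorem coeff_polyOf_fin (a : Fin m → R) (j : Fin m) : (polyOf a).coeff j = a j := by
  rw [coeff_polyOf, dif_pos j.2]

theorem degree_polyOf_lt (a : Fin m → R) : (polyOf a).degree < m := by
  rw [degree_lt_iff_coeff_zero]
  intro j hj
  rw [coeff_polyOf, dif_neg (not_lt.2 hj)]

theorem polyOf_coeff {f : R[X]} (hf : f.degree < m) : polyOf (fun i : Fin m => f.coeff i) = f := by
  ext j
  rw [coeff_polyOf]
  split_ifs with h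
  · rfl
  · exact ((degree_lt_iff_coeff_zero f m).1 hf j (not_lt.1 h)).symm

theorem polyOf_add (a b : Fin m → R) : polyOf (a + b) = polyOf a + polyOf b := by
  simp [polyOf, add_mul, Finset.sum_add_distrib]

theorem polyOf_injective : Function.Injective (polyOf : (Fin m → R) → R[X]) := by
  intro a b h
  ext j
  rw [← coeff_polyOf_fin a, h, coeff_polyOf_fin]

/-- The tuple of coefficients of `A + Z * Q`. -/
noncomputable def divMap (Z : R[X]) (r m n : ℕ) : (Fin r → R) × (Fin m → R) →+ (Fin n → R) where
  toFun AQ i := (polyOf AQ.1 + Z * polyOf AQ.2).coeff i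
  map_zero' := by ext i; simp [polyOf]
  map_add' a b := by
    ext i
    simp only [Prod.fst_add, Prod.snd_add, polyOf_add, Pi.add_apply, mul_add, coeff_add]
    ring

theorem polyOf_divMap {Z : R[X]} {r m n : ℕ} (hZ : Z.natDegree = r) (hn : r + m = n)
    (AQ : (Fin r → R) × (Fin m → R)) :
    polyOf (divMap Z r m n AQ) = polyOf AQ.1 + Z * polyOf AQ.2 := by
  change polyOf (fun i : Fin n => (polyOf AQ.1 + Z * polyOf AQ.2).coeff i) = _
  refine polyOf_coeff (f := polyOf AQ.1 + Z * polyOf AQ.2) ?_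
  rw [degree_lt_iff_coeff_zero]
  intro j hj
  rw [coeff_add, coeff_polyOf, dif_neg (by omega), zero_add, coeff_mul]
  refine Finset.sum_eq_zero fun x hx => ?_
  rw [Finset.HasAntidiagonal.mem_antidiagonal] at hx
  rcases lt_or_ge Z.natDegree x.1 with h | h
  · rw [coeff_eq_zero_of_natDegree_lt h, zero_mul]
  · rw [coeff_polyOf, dif_neg (by omega), mul_zero]

/-- Euclidean division works over any commutative ring because `Z` is monic. Remainder and quotient
have the right numbers of coefficients, so they give a preimage. -/
theorem divMap_surjective {Z : R[X]} (hZm : Z.Monic) {r m n : ℕ} (hZ : Z.natDegree = r)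
    (hn : r + m = n) (hm : 0 < m) : Function.Surjective (divMap Z r m n) := by
  rcases subsingleton_or_nontrivial R with hR | hR
  · exact fun P => ⟨0, Subsingleton.elim _ _⟩
  intro P
  have h1 : (polyOf P %ₘ Z).degree < r := by
    rw [← hZ, ← degree_eq_natDegree hZm.ne_zero]
    exact degree_modByMonic_lt _ hZm
  have h2 : (polyOf P /ₘ Z).degree < m := by
    rw [degree_lt_iff_coeff_zero]
    intro j hj
    refine coeff_eq_zero_of_natDegree_lt ?_
    have h3 : (polyOf P).natDegree < n := by
      rcases eq_or_ne (polyOf P) 0 with h | h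
      · rw [h, natDegree_zero]
        omega
      · exact (natDegree_lt_iff_degree_lt h).2 (degree_polyOf_lt P)
    rw [natDegree_divByMonic _ hZm]
    omega
  refine ⟨(fun i => (polyOf P %ₘ Z).coeff i, fun i => (polyOf P /ₘ Z).coeff i), ?_⟩
  refine polyOf_injective ?_
  rw [polyOf_divMap hZ hn]
  simp only
  rw [polyOf_coeff h1, polyOf_coeff h2, modByMonic_add_div]

theorem continuous_divMap [TopologicalSpace R] [IsTopologicalRing R] (Z : R[X]) (r m n : ℕ) :
    Continuous (divMap Z r m n) := by
  refine continuous_pi fun i => ?_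
  change Continuous fun AQ : (Fin r → R) × (Fin m → R) => (polyOf AQ.1 + Z * polyOf AQ.2).coeff i
  simp only [coeff_add, coeff_mul, coeff_polyOf]
  refine Continuous.add ?_ (continuous_finsetSum _ fun x _ => continuous_const.mul ?_)
  · split_ifs <;> fun_prop
  · split_ifs <;> fun_prop

theorem reverse_surjective :
    Function.Surjective (fun (a : Fin m → R) (i : Fin m) => a i.rev) := fun a =>
  ⟨fun i => a i.rev, by simp⟩

end PolyOf

/-! ### The uniform measure on coefficients. -/

section Measures

variable (p : ℕ) [Fact p.Prime] (F : Type*) [NormedField F] [NormedAlgebra ℚ_[p] F]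
  [FiniteDimensional ℚ_[p] F]

theorem coe_intRing : (intRing p F : Set F) = Metric.closedBall 0 1 := by
  ext x
  simp [intRing]

theorem toPoly_eq (p : ℕ) [Fact p.Prime] (F : Type*) [NormedField F] [NormedAlgebra ℚ_[p] F]
    {n : ℕ} (P : Omega p F n) :
    toPoly p F P = (polyOf P).map (algebraMap (intRing p F) F) := by
  simp only [toPoly, polyOf, Polynomial.map_sum, Polynomial.map_mul, map_C, Polynomial.map_pow,
    map_X]
  rfl

instance compactSpace_intRing : CompactSpace (intRing p F) := by
  haveI := properSpace_base p F
  refine isCompact_iff_compactSpace.1 (?_ : IsCompact (intRing p F : Set F))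
  rw [coe_intRing]
  exact isCompact_closedBall _ _

theorem isOpen_intRing : IsOpen (intRing p F : Set F) := by
  haveI : IsUltrametricDist F := IsUltrametricDist.of_normedAlgebra ℚ_[p]
  rw [coe_intRing]
  exact IsUltrametricDist.isOpen_closedBall _ one_ne_zero

variable [MeasurableSpace F] [BorelSpace F]

/-- The normalized Haar measure on `O_F`. -/
noncomputable abbrev intMeasure : Measure (intRing p F) := (haar p F F).comap Subtype.val

theorem intMeasure_apply (s : Set (intRing p F)) :
    intMeasure p F s = haar p F F (Subtype.val '' s) :=
  (MeasurableEmbedding.subtype_coe (isOpen_intRing p F).measurableSet).comap_apply _ _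

instance isAddHaarMeasure_intMeasure : (intMeasure p F).IsAddHaarMeasure :=
  Measure.IsAddHaarMeasure.comap (mH := inferInstance) (haar p F F) (f := (intRing p F).subtype.toAddMonoidHom)
    (isOpen_intRing p F).isOpenEmbedding_subtypeVal

instance isProbabilityMeasure_intMeasure : IsProbabilityMeasure (intMeasure p F) where
  measure_univ := by
    rw [intMeasure_apply, Set.image_univ, Subtype.range_coe]
    exact (congrArg _ (coe_intRing p F)).trans (haar_closedBall_one p F F)

theorem intMeasure_countable {s : Set (intRing p F)} (hs : s.Countable) : intMeasure p F s = 0 := by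
  haveI := properSpace_base p F
  letI := nontriviallyNormed p F
  rw [intMeasure_apply]
  exact (hs.image _).measure_zero _

/-- The normalized Haar measure on `O_F ^ m`. -/
noncomputable abbrev coeffMeasure (m : ℕ) : Measure (Fin m → intRing p F) :=
  Measure.pi fun _ => intMeasure p F

/-- A surjective continuous homomorphism of compact groups carries Haar probability to Haar
probability, by uniqueness. The same principle serves for coefficient reversal, Euclidean division
and evaluation at a point. -/
theorem map_coeffMeasure {m n : ℕ} (f : (Fin m → intRing p F) →+ (Fin n → intRing p F))
    (hf : Continuous f) (hs : Function.Surjective f) :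
    (coeffMeasure p F m).map f = coeffMeasure p F n := by
  haveI := Measure.isAddHaarMeasure_map_of_isFiniteMeasure (coeffMeasure p F m) f hf hs
  haveI := Measure.isProbabilityMeasure_map (μ := coeffMeasure p F m) hf.measurable.aemeasurable
  exact Measure.isAddHaarMeasure_eq_of_isProbabilityMeasure _ _

theorem map_divMap {Z : (intRing p F)[X]} (hZm : Z.Monic) {r m n : ℕ} (hZ : Z.natDegree = r)
    (hn : r + m = n) (hm : 0 < m) :
    ((coeffMeasure p F r).prod (coeffMeasure p F m)).map (divMap Z r m n) =
      coeffMeasure p F n := by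
  have hf := continuous_divMap Z r m n
  haveI : ((coeffMeasure p F r).prod (coeffMeasure p F m)).IsAddHaarMeasure :=
    Measure.prod.instIsAddHaarMeasure _ _
  haveI := Measure.isAddHaarMeasure_map_of_isFiniteMeasure
    ((coeffMeasure p F r).prod (coeffMeasure p F m)) (divMap Z r m n) hf
    (divMap_surjective hZm hZ hn hm)
  haveI := Measure.isProbabilityMeasure_map
    (μ := (coeffMeasure p F r).prod (coeffMeasure p F m)) hf.measurable.aemeasurable
  exact Measure.isAddHaarMeasure_eq_of_isProbabilityMeasure _ _

/-- A measurable set which meets every line in a given direction in a countable set is null. -/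
theorem coeffMeasure_eq_zero {m : ℕ} {B : Set (Fin m → intRing p F)} (hB : MeasurableSet B)
    (v : Fin m → intRing p F)
    (h : ∀ P, {c : intRing p F | P + (fun i => c * v i) ∈ B}.Countable) :
    coeffMeasure p F m B = 0 := by
  have hcont : Continuous fun x : intRing p F × (Fin m → intRing p F) =>
      x.2 + (fun i => x.1 * v i) := by fun_prop
  have hS := hcont.measurable hB
  -- The pairs `(c, P)` with `P + c v ∈ B` are measured in both orders. Each slice at fixed `c` is a
  -- translate of `B`; each slice at fixed `P` is countable, hence null.
  have h1 := Measure.prod_apply (μ := intMeasure p F) (ν := coeffMeasure p F m) hS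
  have h2 := Measure.prod_apply_symm (μ := intMeasure p F) (ν := coeffMeasure p F m) hS
  have h3 : ∀ c : intRing p F, coeffMeasure p F m (Prod.mk c ⁻¹'
      ((fun x : intRing p F × (Fin m → intRing p F) => x.2 + (fun i => x.1 * v i)) ⁻¹' B)) =
      coeffMeasure p F m B := fun c => measure_preimage_add_right _ (fun i => c * v i) B
  have h4 : ∀ P : Fin m → intRing p F, intMeasure p F ((fun c => (c, P)) ⁻¹'
      ((fun x : intRing p F × (Fin m → intRing p F) => x.2 + (fun i => x.1 * v i)) ⁻¹' B)) = 0 :=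
    fun P => intMeasure_countable p F (h P)
  simp only [h3, lintegral_const, measure_univ, mul_one] at h1
  simp only [h4, lintegral_zero] at h2
  rw [← h1, h2]

theorem map_reverse_polyMeasure (n : ℕ) :
    (polyMeasure p F n).map (fun a i => a i.rev) = polyMeasure p F n :=
  map_coeffMeasure p F (m := n + 1) (n := n + 1)
    ⟨⟨fun a i => a i.rev, rfl⟩, fun _ _ => rfl⟩
    (continuous_pi fun _ => continuous_apply _) reverse_surjective

instance isProbabilityMeasure_polyMeasure (n : ℕ) : IsProbabilityMeasure (polyMeasure p F n) :=
  inferInstanceAs (IsProbabilityMeasure (coeffMeasure p F (n + 1)))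

end Measures

/-! ### Newton's method and balls around simple roots. -/

section Hensel

theorem norm_sub_le_max_of_ultra {E : Type*} [NormedField E] [IsUltrametricDist E] (x y : E) :
    ‖x - y‖ ≤ max ‖x‖ ‖y‖ := by
  rw [sub_eq_add_neg, ← norm_neg y]
  exact IsUltrametricDist.norm_add_le_max x (-y)

variable {E : Type*} [NormedField E] [IsUltrametricDist E]

/-- The closed unit ball of an ultrametric field. -/
def unitBallSubring (E : Type*) [NormedField E] [IsUltrametricDist E] : Subring E where
  carrier := {x | ‖x‖ ≤ 1}
  mul_mem' {a b} ha hb := by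
    simp only [Set.mem_ofPred_eq, norm_mul] at *
    exact mul_le_one₀ ha (norm_nonneg b) hb
  one_mem' := by simp
  zero_mem' := by simp
  add_mem' {a b} ha hb := (IsUltrametricDist.norm_add_le_max a b).trans (max_le ha hb)
  neg_mem' {a} ha := by simpa using ha

/-- The coefficients of a polynomial lie in the closed unit ball. -/
def HasIntegralCoeffs (f : E[X]) : Prop := ∀ i, ‖f.coeff i‖ ≤ 1

variable {f : E[X]}

theorem HasIntegralCoeffs.exists_lift (hf : HasIntegralCoeffs f) :
    ∃ g : (unitBallSubring E)[X], g.map (unitBallSubring E).subtype = f := by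
  rw [← mem_lifts, lifts_iff_coeff_lifts]
  exact fun i => ⟨⟨f.coeff i, hf i⟩, rfl⟩

theorem HasIntegralCoeffs.derivative (hf : HasIntegralCoeffs f) :
    HasIntegralCoeffs f.derivative := by
  obtain ⟨g, rfl⟩ := hf.exists_lift
  intro i
  rw [derivative_map, coeff_map]
  exact (g.derivative.coeff i).2

theorem HasIntegralCoeffs.norm_eval_le_one (hf : HasIntegralCoeffs f) {a : E} (ha : ‖a‖ ≤ 1) :
    ‖f.eval a‖ ≤ 1 := by
  obtain ⟨g, rfl⟩ := hf.exists_lift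
  have := eval_map_apply (unitBallSubring E).subtype (p := g) ⟨a, ha⟩
  erw [this]
  exact (g.eval _).2

/-- The second-order Taylor expansion is carried out inside the ring of the unit ball, so the
remainder coefficient is integral. -/
theorem HasIntegralCoeffs.eval_add (hf : HasIntegralCoeffs f) {a h : E} (ha : ‖a‖ ≤ 1)
    (hh : ‖h‖ ≤ 1) :
    ∃ k : E, ‖k‖ ≤ 1 ∧ f.eval (a + h) = f.eval a + f.derivative.eval a * h + k * h ^ 2 := by
  obtain ⟨g, rfl⟩ := hf.exists_lift
  let a' : unitBallSubring E := ⟨a, ha⟩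
  let h' : unitBallSubring E := ⟨h, hh⟩
  obtain ⟨k, hk⟩ := binomExpansion g a' h'
  refine ⟨k, k.2, ?_⟩
  have := congrArg (unitBallSubring E).subtype hk
  simp only [map_add, map_mul, map_pow, ← eval_map_apply, ← derivative_map] at this
  exact this

theorem norm_sub_le_one {a b : E} (ha : ‖a‖ ≤ 1) (hb : ‖b‖ ≤ 1) : ‖a - b‖ ≤ 1 :=
  (unitBallSubring E).sub_mem (x := a) (y := b) ha hb

theorem HasIntegralCoeffs.norm_eval_sub_le (hf : HasIntegralCoeffs f) {a b : E} (ha : ‖a‖ ≤ 1)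
    (hb : ‖b‖ ≤ 1) : ‖f.eval a - f.eval b‖ ≤ ‖a - b‖ := by
  have hab := norm_sub_le_one ha hb
  obtain ⟨k, hk, h⟩ := hf.eval_add hb hab
  rw [add_sub_cancel] at h
  have h2 : f.eval a - f.eval b = (f.derivative.eval b + k * (a - b)) * (a - b) := by
    rw [h]
    ring
  rw [h2, norm_mul]
  refine mul_le_of_le_one_left (norm_nonneg _) ?_
  refine (IsUltrametricDist.norm_add_le_max _ _).trans
    (max_le (hf.derivative.norm_eval_le_one hb) ?_)
  rw [norm_mul]
  exact mul_le_one₀ hk (norm_nonneg _) hab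

theorem norm_eq_of_norm_sub_lt {x y : E} (h : ‖x - y‖ < ‖y‖) : ‖x‖ = ‖y‖ := by
  have := IsUltrametricDist.norm_add_eq_max_of_norm_ne_norm h.ne
  rwa [sub_add_cancel, max_eq_right h.le] at this

theorem HasIntegralCoeffs.norm_derivative_eq (hf : HasIntegralCoeffs f) {a b : E} (ha : ‖a‖ ≤ 1)
    (hb : ‖b‖ ≤ 1) (h : ‖a - b‖ < ‖f.derivative.eval b‖) :
    ‖f.derivative.eval a‖ = ‖f.derivative.eval b‖ :=
  norm_eq_of_norm_sub_lt ((hf.derivative.norm_eval_sub_le ha hb).trans_lt h)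

theorem norm_le_one_of_norm_sub_le {a x : E} {ε : ℝ} (ha : ‖a‖ ≤ 1) (hε : ε ≤ 1)
    (hx : ‖x - a‖ ≤ ε) : ‖x‖ ≤ 1 := by
  have := (IsUltrametricDist.norm_add_le_max (x - a) a).trans (max_le (hx.trans hε) ha)
  rwa [sub_add_cancel] at this

/-- If `a ≠ b`, dividing the Taylor expansion at `b` by `a - b` gives `f'(b) = -k(a - b)` with `k`
integral, which contradicts the strict inequality. -/
theorem HasIntegralCoeffs.root_unique (hf : HasIntegralCoeffs f) {a b : E} (ha : ‖a‖ ≤ 1)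
    (hb : ‖b‖ ≤ 1) (hfa : f.eval a = 0) (hfb : f.eval b = 0)
    (h : ‖a - b‖ < ‖f.derivative.eval b‖) : a = b := by
  by_contra hne
  obtain ⟨k, hk, h1⟩ := hf.eval_add hb (norm_sub_le_one ha hb)
  rw [add_sub_cancel, hfa, hfb] at h1
  have h2 : (f.derivative.eval b + k * (a - b)) * (a - b) = 0 := by linear_combination -h1
  have h3 : f.derivative.eval b = -(k * (a - b)) := by
    linear_combination (mul_eq_zero.1 h2).resolve_right (sub_ne_zero.2 hne)
  rw [h3, norm_neg, norm_mul] at h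
  exact absurd (mul_le_of_le_one_left (norm_nonneg _) hk) (not_le.2 h)

theorem HasIntegralCoeffs.norm_eval_le_of_near_root (hf : HasIntegralCoeffs f) {x ξ : E} {ε : ℝ}
    (hξ : ‖ξ‖ ≤ 1) (h0 : f.eval ξ = 0) (hε : ε < ‖f.derivative.eval ξ‖) (hx : ‖x - ξ‖ ≤ ε) :
    ‖f.eval x‖ ≤ ε * ‖f.derivative.eval x‖ ∧ ε < ‖f.derivative.eval x‖ := by
  have hε1 : ε ≤ 1 := hε.le.trans (hf.derivative.norm_eval_le_one hξ)
  have hx1 := norm_le_one_of_norm_sub_le hξ hε1 hx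
  have hd := hf.norm_derivative_eq hx1 hξ (hx.trans_lt hε)
  rw [hd]
  refine ⟨?_, hε⟩
  obtain ⟨k, hk, h1⟩ := hf.eval_add hξ (hx.trans hε1)
  rw [add_sub_cancel, h0, zero_add] at h1
  have h2 : f.eval x = (x - ξ) * (f.derivative.eval ξ + k * (x - ξ)) := by rw [h1]; ring
  rw [h2, norm_mul]
  refine mul_le_mul hx ?_ (norm_nonneg _) ((norm_nonneg _).trans hx)
  refine (IsUltrametricDist.norm_add_le_max _ _).trans (max_le le_rfl ?_)
  rw [norm_mul]
  exact (mul_le_of_le_one_left (norm_nonneg _) hk).trans (hx.trans hε.le)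

/-- Newton's iteration with frozen derivative, `z ↦ z - f(z)/f'(a)`, maps the ball of radius `ε`
around `a` to itself and contracts it by the factor `ε/‖f'(a)‖ < 1`. -/
theorem HasIntegralCoeffs.exists_root [CompleteSpace E] (hf : HasIntegralCoeffs f) {a : E} {ε : ℝ}
    (hε0 : 0 < ε) (ha : ‖a‖ ≤ 1) (h : ‖f.eval a‖ ≤ ε * ‖f.derivative.eval a‖) (hε : ε < ‖f.derivative.eval a‖) :
    ∃ ξ, f.eval ξ = 0 ∧ ‖ξ - a‖ ≤ ε := by
  set d := f.derivative.eval a with hd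
  have hd0 : d ≠ 0 := by
    rintro h0
    rw [h0, norm_zero] at hε
    exact hε.not_gt hε0
  have hdpos : 0 < ‖d‖ := norm_pos_iff.2 hd0
  have hε1 : ε ≤ 1 := hε.le.trans (hf.derivative.norm_eval_le_one ha)
  let T : E → E := fun z => z - f.eval z / d
  have hdiff : ∀ z ∈ Metric.closedBall a ε, ∀ w ∈ Metric.closedBall a ε,
      ‖T z - T w‖ ≤ ε / ‖d‖ * ‖z - w‖ := by
    intro z hz w hw
    rw [mem_closedBall_iff_norm] at hz hw
    have hz1 := norm_le_one_of_norm_sub_le ha hε1 hz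
    have hw1 := norm_le_one_of_norm_sub_le ha hε1 hw
    have hzw : ‖z - w‖ ≤ ε := by
      have := norm_sub_le_max_of_ultra (z - a) (w - a)
      rw [sub_sub_sub_cancel_right] at this
      exact this.trans (max_le hz hw)
    obtain ⟨k, hk, h1⟩ := hf.eval_add hw1 (hzw.trans hε1)
    rw [add_sub_cancel] at h1
    have h2 : T z - T w = ((d - f.derivative.eval w) - k * (z - w)) / d * (z - w) := by
      simp only [T, h1]
      field_simp
      ring
    rw [h2, norm_mul, norm_div]
    gcongr
    refine (norm_sub_le_max_of_ultra _ _).trans (max_le ?_ ?_)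
    · refine (hf.derivative.norm_eval_sub_le ha hw1).trans ?_
      rwa [norm_sub_rev]
    · rw [norm_mul]
      exact (mul_le_of_le_one_left (norm_nonneg _) hk).trans hzw
  have hTa : ‖T a - a‖ ≤ ε := by
    simp only [T, sub_sub_cancel_left, norm_neg, norm_div]
    rwa [div_le_iff₀ hdpos]
  have hmaps : Set.MapsTo T (Metric.closedBall a ε) (Metric.closedBall a ε) := by
    intro z hz
    rw [mem_closedBall_iff_norm]
    have h1 := hdiff z hz a (Metric.mem_closedBall_self hε0.le)
    rw [mem_closedBall_iff_norm] at hz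
    have h2 : ‖T z - T a‖ ≤ ε := h1.trans ((mul_le_of_le_one_left (norm_nonneg _)
      ((div_le_one hdpos).2 hε.le)).trans hz)
    have := IsUltrametricDist.norm_add_le_max (T z - T a) (T a - a)
    rw [sub_add_sub_cancel] at this
    exact this.trans (max_le h2 hTa)
  have hc : ContractingWith ⟨ε / ‖d‖, by positivity⟩ (hmaps.restrict T _ _) := by
    refine ⟨?_, LipschitzWith.of_dist_le_mul fun z w => ?_⟩
    · exact (div_lt_one hdpos).2 hε
    · simp only [Subtype.dist_eq, dist_eq_norm]
      exact hdiff z z.2 w w.2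
  obtain ⟨ξ, hξ, hfix, -⟩ := hc.exists_fixedPoint' Metric.isClosed_closedBall.isComplete hmaps
    (Metric.mem_closedBall_self hε0.le) (edist_ne_top _ _)
  refine ⟨ξ, ?_, mem_closedBall_iff_norm.1 hξ⟩
  have h3 : ξ - f.eval ξ / d = ξ := hfix
  have h4 : f.eval ξ / d = 0 := by linear_combination -h3
  exact (div_eq_zero_iff.1 h4).resolve_right hd0

/-- The first inequality says that the Newton step at `x` has length at most `ε`; the second makes
the iteration converge and keeps `‖f'‖` constant on the ball. Stability of `U` keeps the root in `U`
when `x` is, and conversely. -/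
theorem HasIntegralCoeffs.setOf_near_root_eq [CompleteSpace E] (hf : HasIntegralCoeffs f) {ε : ℝ}
    (hε0 : 0 < ε) {U : Set E} (hU1 : ∀ x ∈ U, ‖x‖ ≤ 1) (hU : ∀ x ∈ U, Metric.closedBall x ε ⊆ U) :
    {x | x ∈ U ∧ ‖f.eval x‖ ≤ ε * ‖f.derivative.eval x‖ ∧ ε < ‖f.derivative.eval x‖} =
      ⋃ ξ ∈ {ξ | ξ ∈ U ∧ f.eval ξ = 0 ∧ ε < ‖f.derivative.eval ξ‖}, Metric.closedBall ξ ε := by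
  ext x
  simp only [Set.mem_ofPred_eq, Set.mem_iUnion, exists_prop]
  constructor
  · rintro ⟨hx, h1, h2⟩
    obtain ⟨ξ, hξ, hξx⟩ := hf.exists_root hε0 (hU1 x hx) h1 h2
    have hξU : ξ ∈ U := hU x hx (mem_closedBall_iff_norm.2 hξx)
    refine ⟨ξ, ⟨hξU, hξ, ?_⟩, ?_⟩
    · rwa [hf.norm_derivative_eq (hU1 ξ hξU) (hU1 x hx) (hξx.trans_lt h2)]
    · rwa [mem_closedBall_iff_norm, norm_sub_rev]
  · rintro ⟨ξ, ⟨hξU, hξ, h2⟩, hx⟩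
    exact ⟨hU ξ hξU hx, hf.norm_eval_le_of_near_root (hU1 ξ hξU) hξ h2
      (mem_closedBall_iff_norm.1 hx)⟩

theorem HasIntegralCoeffs.measure_near_root [CompleteSpace E] [MeasurableSpace E] [BorelSpace E]
    (μ : Measure E) [μ.IsAddLeftInvariant] (hf : HasIntegralCoeffs f) {ε : ℝ}
    (hε0 : 0 < ε) {U : Set E} (hU1 : ∀ x ∈ U, ‖x‖ ≤ 1) (hU : ∀ x ∈ U, Metric.closedBall x ε ⊆ U) :
    μ {x | x ∈ U ∧ ‖f.eval x‖ ≤ ε * ‖f.derivative.eval x‖ ∧ ε < ‖f.derivative.eval x‖} =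
      ({ξ | ξ ∈ U ∧ f.eval ξ = 0 ∧ ε < ‖f.derivative.eval ξ‖}.encard : ℝ≥0∞) *
        μ (Metric.closedBall 0 ε) := by
  classical
  rw [hf.setOf_near_root_eq hε0 hU1 hU]
  have hfin : {ξ | ξ ∈ U ∧ f.eval ξ = 0 ∧ ε < ‖f.derivative.eval ξ‖}.Countable := by
    -- The polynomial `f` may be zero; then, as whenever `f' = 0`, no root satisfies the strict
    -- inequality on the derivative.
    rcases eq_or_ne f.derivative 0 with h0 | h0
    · refine Set.countable_empty.mono ?_
      rintro ξ ⟨-, -, hξ⟩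
      rw [h0, eval_zero, norm_zero] at hξ
      exact hξ.not_gt hε0
    · have hf0 : f ≠ 0 := by
        rintro rfl
        simp at h0
      refine (f.roots.toFinset.finite_toSet.subset ?_).countable
      rintro ξ ⟨-, hξ, -⟩
      simpa [hf0] using hξ
  rw [measure_biUnion hfin ?_ fun ξ _ => measurableSet_closedBall]
  · have : ∀ ξ : E, μ (Metric.closedBall ξ ε) = μ (Metric.closedBall 0 ε) := fun ξ => by
      rw [← measure_preimage_add μ ξ]
      congr 1
      ext x
      simp
    simp only [this]
    exact ENNReal.tsum_set_const _ _
  · intro ξ hξ η hη hne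
    refine Set.disjoint_left.2 fun x hx hx' => hne ?_
    rw [mem_closedBall_iff_norm] at hx hx'
    refine hf.root_unique (hU1 _ hξ.1) (hU1 _ hη.1) hξ.2.1 hη.2.1 (lt_of_le_of_lt ?_ hη.2.2)
    have := norm_sub_le_max_of_ultra (x - η) (x - ξ)
    rw [sub_sub_sub_cancel_left] at this
    exact this.trans (max_le hx' hx)

end Hensel

/-! ### Integral elements, minimal polynomials and integral bases. -/

section Integers

variable (p : ℕ) [Fact p.Prime] (F : Type*) [NormedField F] [NormedAlgebra ℚ_[p] F]
  [FiniteDimensional ℚ_[p] F] {E : Type*} [NormedField E] [NormedAlgebra F E]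
  [FiniteDimensional F E]

theorem isUltrametricDist_ext (p : ℕ) [Fact p.Prime] (F : Type*) [NormedField F]
    [NormedAlgebra ℚ_[p] F] (E : Type*) [NormedField E] [NormedAlgebra F E] :
    IsUltrametricDist E :=
  haveI : IsUltrametricDist F := IsUltrametricDist.of_normedAlgebra ℚ_[p]
  IsUltrametricDist.of_normedAlgebra F

instance isFractionRing_intRing : IsFractionRing (intRing p F) F where
  map_units y := by
    refine IsUnit.mk0 _ fun h => nonZeroDivisors.ne_zero y.2 ?_
    exact Subtype.ext h
  surj z := by
    rcases le_total ‖z‖ 1 with h | h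
    · exact ⟨(⟨z, h⟩, 1), by simp; rfl⟩
    · have hz : z ≠ 0 := norm_pos_iff.1 (one_pos.trans_le h)
      have hz' : ‖z⁻¹‖ ≤ 1 := by
        rw [norm_inv]
        exact inv_le_one_of_one_le₀ h
      refine ⟨(1, ⟨⟨z⁻¹, hz'⟩, ?_⟩), ?_⟩
      · rw [mem_nonZeroDivisors_iff_ne_zero]
        exact fun h0 => inv_ne_zero hz (congrArg Subtype.val h0)
      · rw [map_one]
        exact mul_inv_cancel₀ hz
  exists_of_eq {x y} h := ⟨1, by rw [Subtype.ext h]⟩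

theorem isIntegral_intRing {x : E} (hx : ‖x‖ ≤ 1) : IsIntegral (intRing p F) x := by
  haveI := finite_intAlg p F E
  have h : IsIntegral (intRing p F) (⟨x, hx⟩ : intAlg p F E) := Algebra.IsIntegral.isIntegral _
  exact h.algebraMap (B := E)

theorem minpoly_intRing {x : E} (hx : ‖x‖ ≤ 1) :
    minpoly F x = (minpoly (intRing p F) x).map (algebraMap (intRing p F) F) := by
  haveI := isPrincipalIdealRing_intRing p F
  exact minpoly.isIntegrallyClosed_eq_field_fractions' F (isIntegral_intRing p F hx)

theorem span_chooseBasis (p : ℕ) [Fact p.Prime] (F : Type*) [NormedField F]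
    [NormedAlgebra ℚ_[p] F] (E : Type*) [NormedField E] [NormedAlgebra F E] {ι : Type*}
    (b₀ : Module.Basis ι (intRing p F) (intAlg p F E)) :
    (Submodule.span (intRing p F) (Set.range fun i => (b₀ i : E)) : Set E) =
      Metric.closedBall 0 1 := by
  have h1 : (Set.range fun i => (b₀ i : E)) =
      (intAlg p F E).val.toLinearMap '' Set.range b₀ := by
    rw [← Set.range_comp]
    rfl
  rw [h1, ← Submodule.map_span, b₀.span_eq, Submodule.map_top]
  ext y
  rw [mem_closedBall_zero_iff]
  exact ⟨fun ⟨z, hz⟩ => hz ▸ z.2, fun hy => ⟨⟨y, hy⟩, rfl⟩⟩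

theorem linearIndependent_intAlg {ι : Type*}
    (b₀ : Module.Basis ι (intRing p F) (intAlg p F E)) :
    LinearIndependent F fun i => (b₀ i : E) := by
  rw [← LinearIndependent.iff_fractionRing (intRing p F) F]
  exact b₀.linearIndependent.map' (intAlg p F E).val.toLinearMap
    (LinearMap.ker_eq_bot.2 Subtype.val_injective)

theorem span_eq_top_of_span_eq_closedBall {v : Set E}
    (h : (Submodule.span (intRing p F) v : Set E) = Metric.closedBall 0 1) :
    ⊤ ≤ Submodule.span F v := by
  intro y _
  letI := nontriviallyNormed p F
  obtain ⟨c, hc⟩ := NormedField.exists_lt_norm F ‖y‖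
  have hc0 : c ≠ 0 := norm_pos_iff.1 ((norm_nonneg _).trans_lt hc)
  have h1 : c⁻¹ • y ∈ (Submodule.span (intRing p F) v : Set E) := by
    rw [h, mem_closedBall_zero_iff, norm_smul, norm_inv]
    exact inv_mul_le_one_of_le₀ hc.le (norm_nonneg _)
  have h2 : c⁻¹ • y ∈ Submodule.span F v :=
    Submodule.span_le_restrictScalars (intRing p F) F _ h1
  have h3 := Submodule.smul_mem _ c h2
  rwa [smul_inv_smul₀ hc0] at h3

variable (E) in
/-- A basis of `O_E` over `O_F`, as a basis of `E` over `F`. -/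
theorem exists_basis_intAlg : ∃ b : Module.Basis (Fin (Module.finrank F E)) F E,
    Algebra.discr F b = discr p F E ∧
    (Submodule.span (intRing p F) (Set.range b) : Set E) = Metric.closedBall 0 1 := by
  haveI := finite_intAlg p F E
  haveI := free_intAlg p F E
  let b₀ := Module.Free.chooseBasis (intRing p F) (intAlg p F E)
  have hspan := span_chooseBasis p F E b₀
  let b := Module.Basis.mk (linearIndependent_intAlg p F b₀)
    (span_eq_top_of_span_eq_closedBall p F hspan)
  have hb : (b : _ → E) = fun i => (b₀ i : E) := Module.Basis.coe_mk _ _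
  have hcard : Module.finrank F E = Fintype.card
      (Module.Free.ChooseBasisIndex (intRing p F) (intAlg p F E)) :=
    Module.finrank_eq_card_basis b
  let e := (Fintype.equivFinOfCardEq hcard.symm)
  refine ⟨b.reindex e, ?_, ?_⟩
  · rw [Module.Basis.coe_reindex, Algebra.discr_reindex, hb]
    rfl
  · rw [Module.Basis.range_reindex, hb, hspan]

end Integers

/-! ### The order `O_F[x]`: discriminant, volume and index. -/

section Index

variable (p : ℕ) [Fact p.Prime] (F : Type*) [NormedField F] [NormedAlgebra ℚ_[p] F]
  {E : Type*} [NormedField E] [NormedAlgebra F E]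
  [FiniteDimensional F E]

/-- The additive group of `O_F[x]`. -/
noncomputable def adjoinGroup (x : E) : AddSubgroup E :=
  (Algebra.adjoin (intRing p F) {x}).toSubring.toAddSubgroup

/-- The discriminant of the family of powers of `x`. -/
noncomputable def powDiscr (E : Type*) [NormedField E] [NormedAlgebra F E] (x : E) : F :=
  Algebra.discr F fun i : Fin (Module.finrank F E) => x ^ (i : ℕ)

variable {F} in
theorem exists_powerBasis {x : E} (h : Algebra.adjoin F {x} = ⊤) :
    (minpoly F x).natDegree = Module.finrank F E ∧
    ∃ b : Module.Basis (Fin (Module.finrank F E)) F E, ∀ i, b i = x ^ (i : ℕ) := by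
  have hx : IsIntegral F x := Algebra.IsIntegral.isIntegral x
  let pb := PowerBasis.ofAdjoinEqTop hx h
  have h1 : pb.dim = Module.finrank F E := pb.finrank.symm
  refine ⟨h1, pb.basis.reindex (finCongr h1), fun i => ?_⟩
  rw [Module.Basis.reindex_apply, pb.basis_eq_pow]
  rfl

variable [FiniteDimensional ℚ_[p] F]

/-- The minimal polynomial of `x` over `O_F` is monic of degree `[E : F]`, so every polynomial in
`x` reduces to one of smaller degree without leaving `O_F`. -/
theorem span_powers {x : E} (hx : ‖x‖ ≤ 1) (h : Algebra.adjoin F {x} = ⊤) :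
    (Submodule.span (intRing p F)
      (Set.range fun i : Fin (Module.finrank F E) => x ^ (i : ℕ)) : Set E) = adjoinGroup p F x := by
  classical
  have hi := isIntegral_intRing p F hx
  have hdeg : (minpoly (intRing p F) x).natDegree = Module.finrank F E := by
    rw [← (exists_powerBasis h).1, minpoly_intRing p F hx, (minpoly.monic hi).natDegree_map]
  have h1 := Submodule.span_range_natDegree_eq_adjoin (minpoly.monic hi) (minpoly.aeval _ x)
  have h2 : (Set.range fun i : Fin (Module.finrank F E) => x ^ (i : ℕ)) =
      ↑(Finset.image (x ^ ·) (Finset.range (minpoly (intRing p F) x).natDegree)) := by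
    ext y
    simp only [Set.mem_range, Finset.coe_image, Finset.coe_range, Set.mem_image, Set.mem_Iio, hdeg]
    exact ⟨fun ⟨i, hi⟩ => ⟨i, i.2, hi⟩, fun ⟨i, hi, h⟩ => ⟨⟨i, hi⟩, h⟩⟩
  rw [h2, h1]
  rfl

theorem powDiscr_ne_zero [CharZero F] {x : E} (h : Algebra.adjoin F {x} = ⊤) : powDiscr F E x ≠ 0 := by
  obtain ⟨-, b, hb⟩ := exists_powerBasis h
  have : powDiscr F E x = Algebra.discr F b := by
    rw [powDiscr]
    congr 1
    exact (funext hb).symm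
  rw [this]
  exact Algebra.discr_not_zero_of_basis F b

theorem adjoin_eq_top_of_powDiscr_ne_zero {x : E} (h : powDiscr F E x ≠ 0) :
    Algebra.adjoin F {x} = ⊤ := by
  have hli : LinearIndependent F fun i : Fin (Module.finrank F E) => x ^ (i : ℕ) := by
    by_contra h1
    exact h (Algebra.discr_zero_of_not_linearIndependent F h1)
  have h1 := hli.span_eq_top_of_card_eq_finrank' (by simp)
  rw [eq_top_iff, ← Subalgebra.toSubmodule.le_iff_le, Algebra.top_toSubmodule, ← h1,
    Submodule.span_le]
  rintro _ ⟨i, rfl⟩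
  exact Subalgebra.pow_mem _ (Algebra.self_mem_adjoin_singleton F x) _

/-- The discriminant of a power basis is `±N(f'(x))`, where `f` is the minimal polynomial; the sign
has norm `1`. -/
theorem powDiscr_eq_norm {x : E} (h : Algebra.adjoin F {x} = ⊤) :
    pnorm p F (powDiscr F E x) =
      pnorm p F (aeval x (minpoly F x).derivative) ^ Module.finrank F E := by
  haveI := charZero_base p F
  have hx : IsIntegral F x := Algebra.IsIntegral.isIntegral x
  let pb := PowerBasis.ofAdjoinEqTop hx h
  have h1 : pb.dim = Module.finrank F E := pb.finrank.symm
  have h2 := Algebra.discr_powerBasis_eq_norm F pb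
  have h3 : powDiscr F E x = Algebra.discr F pb.basis := by
    rw [← Algebra.discr_reindex F pb.basis (finCongr h1), powDiscr]
    congr 1
    ext i
    rw [Function.comp_apply, pb.basis_eq_pow]
    rfl
  rw [h3, h2, pnorm_mul, ← pnorm_algebraNorm]
  simp [pnorm]
  rfl

variable [MeasurableSpace E] [BorelSpace E]

/-- The linear map `T` taking an integral basis to the powers of `x` takes `O_E` onto `O_F[x]`. It
multiplies volumes by `t = pnorm (det T)` and the discriminant by `det T ^ 2`, so one number `t`
controls both. -/
theorem adjoinGroup_properties {x : E} (hx : ‖x‖ ≤ 1) (h : Algebra.adjoin F {x} = ⊤) :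
    IsOpen (adjoinGroup p F x : Set E) ∧
      ∃ t : ℝ, 0 < t ∧ haar p F E (adjoinGroup p F x) = ENNReal.ofReal t ∧
        pnorm p F (powDiscr F E x) = t ^ 2 * pnorm p F (discr p F E) := by
  haveI := charZero_base p F
  haveI := properSpace_base p F
  letI := nontriviallyNormed p F
  haveI := isUltrametricDist_ext p F E
  obtain ⟨-, b', hb'⟩ := exists_powerBasis h
  obtain ⟨b, hd, hs⟩ := exists_basis_intAlg p F E
  let T := b.equiv b' (Equiv.refl _)
  have hT : ∀ i, T (b i) = b' i := fun i => b.equiv_apply i b' _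
  have himg : T '' Metric.closedBall 0 1 = adjoinGroup p F x := by
    rw [← hs, ← span_powers p F hx h]
    have := congrArg (fun V : Submodule (intRing p F) E => (V : Set E)) (Submodule.map_span
      (T.toLinearMap.restrictScalars (intRing p F)) (Set.range b))
    refine this.trans ?_
    congr 2
    rw [← Set.range_comp]
    ext y
    simp only [Set.mem_range, Function.comp]
    constructor
    · rintro ⟨i, rfl⟩
      exact ⟨i, by rw [← hb']; exact (hT i).symm⟩
    · rintro ⟨j, rfl⟩
      exact ⟨j, (hT _).trans (hb' j)⟩
  have hdet : LinearMap.det T.toLinearMap ≠ 0 := T.isUnit_det'.ne_zero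
  refine ⟨?_, pnorm p F (LinearMap.det T.toLinearMap), pnorm_pos p hdet, ?_, ?_⟩
  · rw [← himg]
    exact T.toContinuousLinearEquiv.toHomeomorph.isOpenMap _
      (IsUltrametricDist.isOpen_closedBall _ one_ne_zero)
  · have hpos := pnorm_pos p (F := F) hdet
    have hm : MeasurableSet (adjoinGroup p F x : Set E) := by
      rw [← himg]
      exact (T.toContinuousLinearEquiv.toHomeomorph.isOpenMap _
        (IsUltrametricDist.isOpen_closedBall _ one_ne_zero)).measurableSet
    have h1 := congrArg (fun ν : Measure E => ν (adjoinGroup p F x))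
      (map_linearMap_haar_ext p F T.toLinearMap hdet)
    simp only [Measure.smul_apply, smul_eq_mul] at h1
    have hTm : Measurable (T.toLinearMap : E → E) :=
      T.toContinuousLinearEquiv.continuous.measurable
    rw [Measure.map_apply hTm hm] at h1
    have h2 : (T.toLinearMap : E → E) ⁻¹' (adjoinGroup p F x : Set E) = Metric.closedBall 0 1 := by
      rw [← himg]
      exact Set.preimage_image_eq _ T.injective
    rw [h2, haar_closedBall_one] at h1
    rw [ENNReal.ofReal_inv_of_pos hpos] at h1
    have hne : ENNReal.ofReal (pnorm p F (LinearMap.det T.toLinearMap)) ≠ 0 := by simpa using hpos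
    rw [← one_mul (haar p F E _), ← ENNReal.mul_inv_cancel hne ENNReal.ofReal_ne_top, mul_assoc,
      ← h1, mul_one]
  · have h3 : powDiscr F E x = Algebra.discr F fun i => T (b i) := by
      have h4 : powDiscr F E x = Algebra.discr F b' := by
        rw [powDiscr]
        congr 1
        exact (funext hb').symm
      rw [h4]
      congr 1
      exact (funext hT).symm
    have h5 : (fun i => T (b i)) =
        Matrix.vecMul b ((LinearMap.toMatrix b b T.toLinearMap).map (algebraMap F E)) := by
      ext j
      simp only [Matrix.vecMul, dotProduct, Matrix.map_apply, LinearMap.toMatrix_apply]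
      conv_lhs => rw [← b.sum_repr (T (b j))]
      refine Finset.sum_congr rfl fun i _ => ?_
      rw [Algebra.smul_def, mul_comm]
      rfl
    rw [h3, h5, Algebra.discr_of_matrix_vecMul, hd, LinearMap.det_toMatrix, pnorm_mul, pow_two,
      pnorm_mul, ← pow_two]

theorem adjoinGroup_le {x : E} (hx : ‖x‖ ≤ 1) :
    adjoinGroup p F x ≤ (intAlg p F E).toSubring.toAddSubgroup := by
  intro y hy
  have : Algebra.adjoin (intRing p F) {x} ≤ intAlg p F E := by
    rw [Algebra.adjoin_le_iff, Set.singleton_subset_iff]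
    exact hx
  exact this hy

/-- The unit ball is a disjoint union of translates of the open subgroup `O_F[x]`, finitely many by
compactness. -/
theorem intIndex_mul_haar {x : E} (hx : ‖x‖ ≤ 1) (h : Algebra.adjoin F {x} = ⊤) :
    (intIndex p F E x : ℝ≥0∞) * haar p F E (adjoinGroup p F x) = 1 := by
  haveI := isUltrametricDist_ext p F E
  haveI := properSpace_ext p F E
  let G : AddSubgroup E := (intAlg p F E).toSubring.toAddSubgroup
  have hG : (G : Set E) = Metric.closedBall 0 1 := by
    ext y
    simp [G, intAlg]
  have hGo : IsOpen (G : Set E) := by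
    rw [hG]
    exact IsUltrametricDist.isOpen_closedBall _ one_ne_zero
  haveI : CompactSpace G := by
    refine isCompact_iff_compactSpace.1 (?_ : IsCompact (G : Set E))
    rw [hG]
    exact isCompact_closedBall _ _
  let H : AddSubgroup G := (adjoinGroup p F x).addSubgroupOf G
  have hH : IsOpen (H : Set G) :=
    (adjoinGroup_properties p F hx h).1.preimage continuous_subtype_val
  haveI : H.FiniteIndex := by
    haveI := H.quotient_finite_of_isOpen hH
    exact AddSubgroup.finiteIndex_of_finite_quotient
  have happ : ∀ s : Set G, (haar p F E).comap (Subtype.val : G → E) s =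
      haar p F E (Subtype.val '' s) := fun s =>
    (MeasurableEmbedding.subtype_coe hGo.measurableSet).comap_apply _ _
  haveI : ((haar p F E).comap (Subtype.val : G → E)).IsAddHaarMeasure :=
    Measure.IsAddHaarMeasure.comap (mH := inferInstance) (haar p F E) (f := G.subtype)
      hGo.isOpenEmbedding_subtypeVal
  have h1 := H.index_mul_measure hH.measurableSet ((haar p F E).comap (Subtype.val : G → E))
  rw [happ, happ, Set.image_univ, Subtype.range_coe] at h1
  have h2 : Subtype.val '' (H : Set G) = (adjoinGroup p F x : Set E) := by
    ext y
    constructor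
    · rintro ⟨z, hz, rfl⟩
      exact hz
    · intro hy
      exact ⟨⟨y, adjoinGroup_le p F hx hy⟩, hy, rfl⟩
  have h3 : haar p F E (G : Set E) = 1 := by rw [hG, haar_closedBall_one]
  rw [h2] at h1
  exact h1.trans h3

theorem intIndex_sq_mul {x : E} (hx : ‖x‖ ≤ 1) (h : Algebra.adjoin F {x} = ⊤) :
    (intIndex p F E x : ℝ) ^ 2 * pnorm p F (powDiscr F E x) = pnorm p F (discr p F E) ∧
      0 < (intIndex p F E x : ℝ) := by
  obtain ⟨-, t, ht, h1, h2⟩ := adjoinGroup_properties p F hx h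
  have h3 := intIndex_mul_haar p F hx h
  rw [h1, ← ENNReal.ofReal_natCast, ← ENNReal.ofReal_mul (Nat.cast_nonneg _),
    ENNReal.ofReal_eq_one] at h3
  refine ⟨?_, ?_⟩
  · rw [h2]
    linear_combination ((intIndex p F E x : ℝ) * t + 1) * h3 * pnorm p F (discr p F E)
  · exact pos_of_mul_pos_left (h3 ▸ one_pos) ht.le

/-- Converts the constant produced by the limit computation, on the left, into the one of the
theorem: `pnorm` of the discriminant of the powers of `x` is `pnorm` of `D_E` divided by the squared
index. -/
theorem intIndex_mul_pow {x : E} (hx : ‖x‖ ≤ 1) (h : Algebra.adjoin F {x} = ⊤) :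
    (intIndex p F E x : ℝ) * pnorm p F (aeval x (minpoly F x).derivative) ^ Module.finrank F E =
      pnorm p F (discr p F E) / intIndex p F E x := by
  obtain ⟨h1, h2⟩ := intIndex_sq_mul p F hx h
  rw [← powDiscr_eq_norm p F h, ← h1]
  field_simp

end Index

/-! ### Multiplicative Haar measure and the change of variables `x ↦ x⁻¹`. -/

section Inversion

variable (p : ℕ) [Fact p.Prime] (F : Type*) [NormedField F] [NormedAlgebra ℚ_[p] F]
  [FiniteDimensional ℚ_[p] F]
  {E : Type*} [NormedField E] [NormedAlgebra F E] [FiniteDimensional F E]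
  [MeasurableSpace E] [BorelSpace E]

/-- The module `‖x‖ ^ [E : ℚ_p]` of `x`. -/
noncomputable def modulus (E : Type*) [NormedField E] [NormedAlgebra F E] (x : E) : ℝ :=
  pnorm p F x ^ Module.finrank F E

theorem modulus_mul (x y : E) : modulus p F E (x * y) = modulus p F E x * modulus p F E y := by
  rw [modulus, pnorm_mul, mul_pow]
  rfl

theorem modulus_inv (x : E) : modulus p F E x⁻¹ = (modulus p F E x)⁻¹ := by
  simp [modulus, pnorm]

theorem modulus_nonneg (x : E) : 0 ≤ modulus p F E x := pow_nonneg (pnorm_nonneg p x) _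

theorem modulus_pos {x : E} (hx : x ≠ 0) : 0 < modulus p F E x := pow_pos (pnorm_pos p hx) _

theorem continuous_modulus : Continuous (modulus p F E) := by
  unfold modulus pnorm
  fun_prop

theorem haar_singleton_zero : haar p F E {0} = 0 := by
  haveI := properSpace_ext p F E
  letI := nontriviallyNormed p F
  letI : NontriviallyNormedField E :=
    { ‹NormedField E› with
      non_trivial := by
        obtain ⟨k, hk⟩ := NontriviallyNormedField.non_trivial (α := F)
        exact ⟨algebraMap F E k, by simpa using hk⟩ }
  exact measure_singleton 0

/-- The multiplicative Haar measure `dx / |x|`. -/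
noncomputable def mulHaar : Measure E :=
  (haar p F E).withDensity fun x => ENNReal.ofReal (modulus p F E x)⁻¹

theorem measurable_weight : Measurable fun x : E => ENNReal.ofReal (modulus p F E x)⁻¹ :=
  (continuous_modulus p F).measurable.inv.ennreal_ofReal

instance sFinite_mulHaar : SFinite (mulHaar p F : Measure E) := by
  haveI := sigmaFinite_haar p F E
  unfold mulHaar
  infer_instance

theorem lintegral_mulHaar {g : E → ℝ≥0∞} (hg : Measurable g) :
    ∫⁻ x, g x ∂(mulHaar p F) =
      ∫⁻ x, ENNReal.ofReal (modulus p F E x)⁻¹ * g x ∂(haar p F E) :=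
  lintegral_withDensity_eq_lintegral_mul _ (measurable_weight p F) hg

theorem lintegral_mulHaar_mul {g : E → ℝ≥0∞} (hg : Measurable g) {a : E} (ha : a ≠ 0) :
    ∫⁻ x, g (a * x) ∂(mulHaar p F) = ∫⁻ x, g x ∂(mulHaar p F) := by
  haveI := properSpace_ext p F E
  have h := map_mul_haar p F a ha
  have hpos := modulus_pos p F ha
  rw [lintegral_mulHaar p F (g := fun x => g (a * x)) (hg.comp (measurable_const_mul a)), lintegral_mulHaar p F hg]
  let G : E → ℝ≥0∞ := fun y => ENNReal.ofReal (modulus p F E y)⁻¹ * g y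
  have hG : Measurable G := (measurable_weight p F).mul hg
  have h1 : ∀ x : E, ENNReal.ofReal (modulus p F E x)⁻¹ * g (a * x) =
      ENNReal.ofReal (modulus p F E a) * G (a * x) := by
    intro x
    simp only [G]
    rw [← mul_assoc, ← ENNReal.ofReal_mul (modulus_nonneg p F a), modulus_mul, mul_inv,
      mul_inv_cancel_left₀ hpos.ne']
  simp only [h1]
  have hGa : Measurable fun x => G (a * x) := hG.comp (measurable_const_mul a)
  rw [lintegral_const_mul _ hGa,
    ← lintegral_map hG (measurable_const_mul a), h, lintegral_smul_measure, smul_eq_mul,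
    ← mul_assoc, ← ENNReal.ofReal_mul (modulus_nonneg p F a)]
  rw [show pnorm p F a ^ Module.finrank F E = modulus p F E a from rfl, mul_inv_cancel₀ hpos.ne',
    ENNReal.ofReal_one, one_mul]

theorem ae_ne_zero_mulHaar : ∀ᵐ x : E ∂(mulHaar p F), x ≠ 0 := by
  have : (mulHaar p F : Measure E) {0} = 0 :=
    (withDensity_absolutelyContinuous _ _) (haar_singleton_zero p F)
  rw [ae_iff]
  simpa using this

theorem mulHaar_sphere : 0 < (mulHaar p F : Measure E) {x | ‖x‖ = 1} ∧
    (mulHaar p F : Measure E) {x | ‖x‖ = 1} < ∞ := by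
  haveI := isUltrametricDist_ext p F E
  have hs : {x : E | ‖x‖ = 1} = Metric.sphere 0 1 := by
    ext x
    simp
  have hm : MeasurableSet {x : E | ‖x‖ = 1} := by
    rw [hs]
    exact Metric.isClosed_sphere.measurableSet
  have h1 : (mulHaar p F : Measure E) {x | ‖x‖ = 1} = haar p F E {x | ‖x‖ = 1} := by
    rw [mulHaar, withDensity_apply _ hm, setLIntegral_congr_fun (g := fun _ => 1) hm]
    · simp
    · intro x hx
      have hx' : ‖x‖ = 1 := hx
      simp [modulus, pnorm, hx']
  rw [h1]
  constructor
  · have ho : IsOpen {x : E | ‖x‖ = 1} := by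
      rw [hs]
      exact IsUltrametricDist.isOpen_sphere _ one_ne_zero
    exact ho.measure_pos _ ⟨1, by simp⟩
  · refine lt_of_le_of_lt (measure_mono (t := Metric.closedBall 0 1) fun x hx => ?_)
      (by rw [haar_closedBall_one]; exact ENNReal.one_lt_top)
    simpa using le_of_eq hx

/-- The uniqueness argument for Haar measure: let `h` be the indicator of the unit sphere, whose
measure is positive and finite. Scaling each variable by the other and exchanging the integrals
turns the double integral of `g(x⁻¹)h(y)` into that of `g(y)h(x)`, and the integral of `h` cancels.
-/
theorem lintegral_mulHaar_inv {g : E → ℝ≥0∞} (hg : Measurable g) :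
    ∫⁻ x, g x⁻¹ ∂(mulHaar p F) = ∫⁻ x, g x ∂(mulHaar p F) := by
  haveI := properSpace_ext p F E
  let h : E → ℝ≥0∞ := Set.indicator {x | ‖x‖ = 1} 1
  have hh : Measurable h :=
    measurable_one.indicator (measurableSet_eq_fun measurable_norm measurable_const)
  have hS : ∫⁻ x, h x ∂(mulHaar p F) = (mulHaar p F : Measure E) {x | ‖x‖ = 1} :=
    lintegral_indicator_one (measurableSet_eq_fun measurable_norm measurable_const)
  obtain ⟨hpos, hfin⟩ := mulHaar_sphere p F (E := E)
  have h1 : ∫⁻ x, ∫⁻ y, g x⁻¹ * h y ∂(mulHaar p F) ∂(mulHaar p F : Measure E) =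
      ∫⁻ x, ∫⁻ y, g y * h x ∂(mulHaar p F) ∂(mulHaar p F) := by
    calc ∫⁻ x, ∫⁻ y, g x⁻¹ * h y ∂(mulHaar p F) ∂(mulHaar p F : Measure E)
        = ∫⁻ x, ∫⁻ y, g x⁻¹ * h (x * y) ∂(mulHaar p F) ∂(mulHaar p F) := by
          refine lintegral_congr_ae ((ae_ne_zero_mulHaar p F).mono fun x hx => ?_)
          exact (lintegral_mulHaar_mul p F (hh.const_mul (g x⁻¹)) hx).symm
      _ = ∫⁻ y, ∫⁻ x, g x⁻¹ * h (x * y) ∂(mulHaar p F) ∂(mulHaar p F) := by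
          refine lintegral_lintegral_swap (Measurable.aemeasurable ?_)
          exact (hg.comp measurable_fst.inv).mul (hh.comp (measurable_fst.mul measurable_snd))
      _ = ∫⁻ y, ∫⁻ x, g (y * x⁻¹) * h x ∂(mulHaar p F) ∂(mulHaar p F) := by
          refine lintegral_congr_ae ((ae_ne_zero_mulHaar p F).mono fun y hy => ?_)
          have hm : Measurable fun x => g x⁻¹ * h (x * y) :=
            (hg.comp measurable_inv).mul (hh.comp (measurable_id.mul_const y))
          refine (lintegral_mulHaar_mul p F hm (inv_ne_zero hy)).symm.trans ?_
          refine lintegral_congr fun x => ?_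
          rw [mul_inv, inv_inv, mul_right_comm, inv_mul_cancel₀ hy, one_mul]
      _ = ∫⁻ x, ∫⁻ y, g (y * x⁻¹) * h x ∂(mulHaar p F) ∂(mulHaar p F) := by
          refine lintegral_lintegral_swap (Measurable.aemeasurable ?_)
          exact (hg.comp (measurable_fst.mul measurable_snd.inv)).mul (hh.comp measurable_snd)
      _ = ∫⁻ x, ∫⁻ y, g y * h x ∂(mulHaar p F) ∂(mulHaar p F) := by
          refine lintegral_congr_ae ((ae_ne_zero_mulHaar p F).mono fun x hx => ?_)
          simp only [mul_comm _ x⁻¹]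
          exact lintegral_mulHaar_mul p F (hg.mul_const (h x)) (inv_ne_zero hx)
  simp only [lintegral_const_mul _ hh, lintegral_mul_const _ hg, hS] at h1
  have hgi : Measurable fun x => g x⁻¹ := hg.comp measurable_inv
  rw [lintegral_mul_const _ hgi] at h1
  exact (ENNReal.mul_left_inj hpos.ne' hfin.ne).1 h1

/-- Change of variables for the inversion of a local field. -/
theorem lintegral_haar_inv {g : E → ℝ≥0∞} (hg : Measurable g) :
    ∫⁻ x, g x ∂(haar p F E) =
      ∫⁻ x, ENNReal.ofReal (modulus p F E x ^ 2)⁻¹ * g x⁻¹ ∂(haar p F E) := by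
  haveI := properSpace_ext p F E
  have hG : Measurable fun x : E => ENNReal.ofReal (modulus p F E x) * g x :=
    (continuous_modulus p F).measurable.ennreal_ofReal.mul hg
  have hae : ∀ᵐ x ∂(haar p F E), x ≠ 0 := by
    rw [ae_iff]
    simpa using haar_singleton_zero p F
  have h1 := lintegral_mulHaar_inv p F hG
  have hGi : Measurable fun x : E => ENNReal.ofReal (modulus p F E x⁻¹) * g x⁻¹ :=
    hG.comp measurable_inv
  rw [lintegral_mulHaar p F hG, lintegral_mulHaar p F hGi] at h1
  rw [← lintegral_congr_ae (hae.mono fun x hx => ?_), ← h1]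
  · refine lintegral_congr fun x => ?_
    rw [← mul_assoc, ← ENNReal.ofReal_mul (inv_nonneg.2 (modulus_nonneg p F x)), modulus_inv,
      ← mul_inv, ← pow_two]
  · rw [← mul_assoc, ← ENNReal.ofReal_mul (inv_nonneg.2 (modulus_nonneg p F x)),
      inv_mul_cancel₀ (modulus_pos p F hx).ne', ENNReal.ofReal_one, one_mul]

end Inversion

/-! ### Measurability of the number of points in a fibre. -/

section Counting

/-- The open set `U` is a countable union of compact sets, over each of which the closed set `T` is
compact and has a compact projection. -/
theorem measurableSet_exists_mem {E X : Type*} [MetricSpace E] [ProperSpace E] [TopologicalSpace X]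
    [CompactSpace X] [T2Space X] [MeasurableSpace X] [BorelSpace X] {U : Set E} (hU : IsOpen U)
    {T : Set (E × X)} (hT : IsClosed T) : MeasurableSet {P | ∃ x ∈ U, (x, P) ∈ T} := by
  obtain ⟨C, hC, -, hCU, -⟩ := hU.exists_iUnion_isClosed
  have h : {P | ∃ x ∈ U, (x, P) ∈ T} =
      ⋃ n, ⋃ k, Prod.snd '' (((C n ∩ compactCovering E k) ×ˢ Set.univ) ∩ T) := by
    ext P
    simp only [Set.mem_ofPred_eq, Set.mem_iUnion, Set.mem_image, Set.mem_inter_iff, Set.mem_prod,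
      Set.mem_univ, and_true, Prod.exists, exists_eq_right]
    constructor
    · rintro ⟨x, hx, hxP⟩
      rw [← hCU, Set.mem_iUnion] at hx
      obtain ⟨n, hn⟩ := hx
      have hk : x ∈ ⋃ k, compactCovering E k := by
        rw [iUnion_compactCovering]
        trivial
      obtain ⟨k, hk⟩ := Set.mem_iUnion.1 hk
      exact ⟨n, k, x, ⟨hn, hk⟩, hxP⟩
    · rintro ⟨n, k, x, ⟨hn, hk⟩, hxP⟩
      exact ⟨x, hCU ▸ Set.mem_iUnion_of_mem n hn, hxP⟩
  rw [h]
  refine MeasurableSet.iUnion fun n => MeasurableSet.iUnion fun k => IsClosed.measurableSet ?_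
  refine IsCompact.isClosed (IsCompact.image ?_ continuous_snd)
  exact ((((isCompact_compactCovering E k).inter_left (hC n)).prod isCompact_univ).inter_right hT)

theorem encard_le_of_forall_finset {α : Type*} {S : Set α} {a : ℝ≥0∞}
    (h : ∀ t : Finset α, (t : Set α) ⊆ S → (t.card : ℝ≥0∞) ≤ a) : (S.encard : ℝ≥0∞) ≤ a := by
  rcases S.finite_or_infinite with hS | hS
  · rw [hS.encard_eq_coe_toFinset_card]
    exact h _ (by simp)
  · have : a = ∞ := by
      refine ENNReal.eq_top_of_forall_nnreal_le fun r => ?_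
      obtain ⟨n, hn⟩ := exists_nat_ge r
      obtain ⟨t, ht, htn⟩ := hS.exists_subset_card_eq n
      have := h t ht
      rw [htn] at this
      exact le_trans (by exact_mod_cast hn) this
    rw [this]
    exact le_top

/-- The number of points is the supremum, over finite disjoint families of basic open subsets of
`U`, of the number of members that meet the fibre. Finitely many points can be separated by such a
family, and there are only countably many families. -/
theorem measurable_encard_fiber {E X : Type*} [MetricSpace E] [ProperSpace E] [TopologicalSpace X]
    [CompactSpace X] [T2Space X] [MeasurableSpace X] [BorelSpace X] {U : Set E} (hU : IsOpen U)
    {T : Set (E × X)} (hT : IsClosed T) :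
    Measurable fun P => ({x | x ∈ U ∧ (x, P) ∈ T}.encard : ℝ≥0∞) := by
  classical
  let B := TopologicalSpace.countableBasis E
  have hB := TopologicalSpace.isBasis_countableBasis E
  haveI : Countable B := (TopologicalSpace.countable_countableBasis E).to_subtype
  let I := {s : Finset B // (∀ b ∈ s, (b : Set E) ⊆ U) ∧ (s : Set B).PairwiseDisjoint Subtype.val}
  let hit : B → Set X := fun b => {P | ∃ x ∈ (b : Set E), (x, P) ∈ T}
  have heq : (fun P => ({x | x ∈ U ∧ (x, P) ∈ T}.encard : ℝ≥0∞)) =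
      fun P => ⨆ s : I, ∑ b ∈ s.1, (hit b).indicator (1 : X → ℝ≥0∞) P := by
    ext P
    refine le_antisymm (encard_le_of_forall_finset fun t ht => ?_) (iSup_le fun s => ?_)
    · obtain ⟨V, hV, hVd⟩ := t.finite_toSet.t2_separation
      have hb : ∀ x : t, ∃ b : B, (x : E) ∈ (b : Set E) ∧ (b : Set E) ⊆ V x ∩ U := fun x => by
        obtain ⟨b, hb, hxb, hbV⟩ := hB.exists_subset_of_mem_open
          (⟨(hV x).1, (ht x.2).1⟩ : (x : E) ∈ V x ∩ U) ((hV x).2.inter hU)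
        exact ⟨⟨b, hb⟩, hxb, hbV⟩
      choose b hb1 hb2 using hb
      have hdis : ∀ x y : t, x ≠ y → Disjoint (b x : Set E) (b y) := fun x y hxy =>
        (hVd x.2 y.2 (fun h => hxy (Subtype.ext h))).mono
          ((hb2 x).trans Set.inter_subset_left) ((hb2 y).trans Set.inter_subset_left)
      have hinj : Function.Injective b := by
        intro x y hxy
        by_contra hne
        have := hdis x y hne
        rw [hxy] at this
        exact Set.disjoint_left.1 this (hb1 y) (hb1 y)
      let s : I := ⟨Finset.univ.image b, by
        constructor
        · intro c hc
          obtain ⟨x, -, rfl⟩ := Finset.mem_image.1 hc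
          exact (hb2 x).trans Set.inter_subset_right
        · intro c hc d hd hcd
          obtain ⟨x, -, rfl⟩ := Finset.mem_image.1 hc
          obtain ⟨y, -, rfl⟩ := Finset.mem_image.1 hd
          exact hdis x y fun h => hcd (h ▸ rfl)⟩
      refine le_trans (le_of_eq ?_) (le_iSup _ s)
      rw [Finset.sum_image fun x _ y _ h => hinj h]
      rw [Finset.sum_congr rfl (g := fun _ => 1)]
      · simp
      · intro x _
        have hP : P ∈ hit (b x) := ⟨x, hb1 x, (ht x.2).2⟩
        simp [hP]
    · have h1 : ∑ b ∈ s.1, (hit b).indicator (1 : X → ℝ≥0∞) P =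
          ((s.1.filter fun b => P ∈ hit b).card : ℝ≥0∞) := by
        simp [Set.indicator_apply]
      have hc : ∀ b : {b // b ∈ s.1.filter fun b => P ∈ hit b}, ∃ x, x ∈ (b.1 : Set E) ∧
          (x, P) ∈ T := fun b => (Finset.mem_filter.1 b.2).2
      choose y hy1 hy2 using hc
      have hinj : Function.Injective y := by
        intro b c hbc
        by_contra hne
        have := s.2.2 (Finset.mem_filter.1 b.2).1 (Finset.mem_filter.1 c.2).1
          (fun h => hne (Subtype.ext h))
        exact Set.disjoint_left.1 this (hy1 b) (hbc ▸ hy1 c)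
      rw [h1]
      have h2 : ((s.1.filter fun b => P ∈ hit b).card : ℕ∞) ≤
          {x | x ∈ U ∧ (x, P) ∈ T}.encard := by
        have h3 : Set.range y ⊆ {x | x ∈ U ∧ (x, P) ∈ T} := by
          rintro _ ⟨b, rfl⟩
          exact ⟨s.2.1 _ (Finset.mem_filter.1 b.2).1 (hy1 b), hy2 b⟩
        refine le_trans (le_of_eq ?_) (Set.encard_le_encard h3)
        rw [← Set.image_univ, hinj.encard_image, Set.encard_univ, ENat.card_eq_coe_fintype_card,
          Fintype.card_coe]
      have h4 := ENat.toENNReal_le.2 h2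
      simpa using h4
  rw [heq]
  refine Measurable.iSup fun s => Finset.measurable_sum _ fun b _ => ?_
  exact measurable_one.indicator (measurableSet_exists_mem
    (TopologicalSpace.isOpen_of_mem_countableBasis b.2) hT)

end Counting

/-! ### Evaluation of random polynomials and approximate roots. -/

section Evaluation

variable {p : ℕ} [Fact p.Prime] {F : Type*} [NormedField F] [NormedAlgebra ℚ_[p] F]
  {E : Type*} [NormedField E] [NormedAlgebra F E] {m : ℕ}

/-- The value at `x` of the polynomial with given coefficients in `O_F`. -/
noncomputable def ev (x : E) (P : Fin m → intRing p F) : E := aeval x (polyOf P)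

/-- The derivative at `x` of the polynomial with given coefficients in `O_F`. -/
noncomputable def dv (x : E) (P : Fin m → intRing p F) : E := aeval x (polyOf P).derivative

theorem ev_eq_sum (x : E) (P : Fin m → intRing p F) :
    ev x P = ∑ i : Fin m, P i • x ^ (i : ℕ) := by
  simp [ev, polyOf, Algebra.smul_def]

theorem dv_eq_sum (x : E) (P : Fin m → intRing p F) :
    dv x P = ∑ i : Fin m, P i • ((i : ℕ) * x ^ ((i : ℕ) - 1)) := by
  simp [dv, polyOf, Algebra.smul_def, derivative_X_pow]

theorem continuous_ev : Continuous fun z : E × (Fin m → intRing p F) => ev z.1 z.2 := by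
  simp only [ev_eq_sum, Subring.smul_def]
  fun_prop

theorem continuous_dv : Continuous fun z : E × (Fin m → intRing p F) => dv z.1 z.2 := by
  simp only [dv_eq_sum, Subring.smul_def]
  fun_prop

theorem aeval_toPoly {n : ℕ} (x : E) (P : Omega p F n) : aeval x (toPoly p F P) = ev x P := by
  rw [toPoly_eq, aeval_map_algebraMap]
  rfl

theorem ev_add (x : E) (P Q : Fin m → intRing p F) : ev x (P + Q) = ev x P + ev x Q := by
  rw [ev, polyOf_add, map_add]
  rfl

theorem dv_add (x : E) (P Q : Fin m → intRing p F) : dv x (P + Q) = dv x P + dv x Q := by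
  rw [dv, polyOf_add, map_add, map_add]
  rfl

theorem hasIntegralCoeffs_map (P : Fin m → intRing p F) [IsUltrametricDist E] :
    HasIntegralCoeffs ((polyOf P).map (algebraMap (intRing p F) E)) := by
  intro i
  rw [coeff_map]
  change ‖algebraMap F E ((polyOf P).coeff i : F)‖ ≤ 1
  rw [norm_algebraMap']
  exact ((polyOf P).coeff i).2

theorem eval_map_polyOf (x : E) (P : Fin m → intRing p F) :
    ((polyOf P).map (algebraMap (intRing p F) E)).eval x = ev x P :=
  eval_map_algebraMap _ _

theorem eval_derivative_map_polyOf (x : E) (P : Fin m → intRing p F) :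
    ((polyOf P).map (algebraMap (intRing p F) E)).derivative.eval x = dv x P := by
  rw [derivative_map]
  exact eval_map_algebraMap _ _

theorem norm_dv_le_one {x : E} (hx : ‖x‖ ≤ 1) (P : Fin m → intRing p F) : ‖dv x P‖ ≤ 1 := by
  haveI := isUltrametricDist_ext p F E
  rw [← eval_derivative_map_polyOf]
  exact (hasIntegralCoeffs_map P).derivative.norm_eval_le_one hx

/-- The approximate root condition: `x` is close to a root at which the derivative is not too
small. -/
def NearRoot (ε : ℝ) (x : E) (P : Fin m → intRing p F) : Prop :=
  ‖ev x P‖ ≤ ε * ‖dv x P‖ ∧ ε < ‖dv x P‖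

variable [FiniteDimensional ℚ_[p] F] [MeasurableSpace F] [BorelSpace F] [FiniteDimensional F E]
  [MeasurableSpace E] [BorelSpace E]

theorem measurableSet_nearRoot (ε : ℝ) :
    MeasurableSet {z : E × (Fin m → intRing p F) | NearRoot ε z.1 z.2} := by
  haveI := properSpace_ext p F E
  have h1 : Measurable fun z : E × (Fin m → intRing p F) => ‖ev z.1 z.2‖ :=
    continuous_ev.norm.measurable
  have h2 : Measurable fun z : E × (Fin m → intRing p F) => ‖dv z.1 z.2‖ :=
    continuous_dv.norm.measurable
  exact (measurableSet_le h1 (h2.const_mul ε)).inter (measurableSet_lt measurable_const h2)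

variable (p F E) in
/-- The probability density of approximate roots. -/
noncomputable def rootDensity (n : ℕ) (ε : ℝ) (x : E) : ℝ≥0∞ :=
  polyMeasure p F n {P | NearRoot ε x P} / haar p F E (Metric.closedBall 0 ε)

theorem measurable_rootDensity (n : ℕ) (ε : ℝ) : Measurable (rootDensity p F E n ε) :=
  (measurable_measure_prodMk_left (measurableSet_nearRoot ε)).div_const _

theorem haar_closedBall_ne {ε : ℝ} (hε : 0 < ε) : haar p F E (Metric.closedBall 0 ε) ≠ 0 ∧
    haar p F E (Metric.closedBall 0 ε) ≠ ∞ := by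
  haveI := properSpace_ext p F E
  exact ⟨(Metric.measure_closedBall_pos _ _ hε).ne', (isCompact_closedBall _ _).measure_lt_top.ne⟩

theorem haar_nearRoot {U : Set E} (hU1 : ∀ x ∈ U, ‖x‖ ≤ 1) {ε : ℝ} (hε : 0 < ε)
    (hU : ∀ x ∈ U, Metric.closedBall x ε ⊆ U) (P : Fin m → intRing p F) :
    haar p F E {x | x ∈ U ∧ NearRoot ε x P} / haar p F E (Metric.closedBall 0 ε) =
      ({ξ | ξ ∈ U ∧ ev ξ P = 0 ∧ ε < ‖dv ξ P‖}.encard : ℝ≥0∞) := by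
  haveI := properSpace_ext p F E
  haveI := isUltrametricDist_ext p F E
  have h := (hasIntegralCoeffs_map (E := E) P).measure_near_root (haar p F E) hε hU1 hU
  simp only [eval_map_polyOf, eval_derivative_map_polyOf] at h
  obtain ⟨h1, h2⟩ := haar_closedBall_ne (p := p) (F := F) (E := E) hε
  rw [ENNReal.eq_div_iff h1 h2 |>.2 ((mul_comm _ _).trans h.symm)]
  rfl

/-- Both sides are the measure of the pairs `(x, P)` with `x ∈ U` and `NearRoot ε x P`, divided by
the volume of a ball of radius `ε`. The left side integrates over `x` first, the right side over `P`
first. -/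
theorem lintegral_encard_eq_rootDensity {U : Set E} (hU1 : ∀ x ∈ U, ‖x‖ ≤ 1) (hUm : MeasurableSet U)
    {ε : ℝ} (hε : 0 < ε) (hU : ∀ x ∈ U, Metric.closedBall x ε ⊆ U) (n : ℕ) :
    ∫⁻ P : Omega p F n, ({ξ | ξ ∈ U ∧ ev ξ P = 0 ∧ ε < ‖dv ξ P‖}.encard : ℝ≥0∞)
      ∂(polyMeasure p F n) = ∫⁻ x in U, rootDensity p F E n ε x ∂(haar p F E) := by
  haveI := sigmaFinite_haar p F E
  have hN := measurableSet_nearRoot (p := p) (F := F) (E := E) (m := n + 1) ε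
  have h1 := Measure.prod_apply (μ := (haar p F E).restrict U) (ν := coeffMeasure p F (n + 1)) hN
  have h2 := Measure.prod_apply_symm (μ := (haar p F E).restrict U)
    (ν := coeffMeasure p F (n + 1)) hN
  obtain ⟨h3, h4⟩ := haar_closedBall_ne (p := p) (F := F) (E := E) hε
  have h5 : ∀ P : Omega p F n, ({ξ | ξ ∈ U ∧ ev ξ P = 0 ∧ ε < ‖dv ξ P‖}.encard : ℝ≥0∞) =
      ((haar p F E).restrict U) ((fun x => (x, P)) ⁻¹' {z : E × Omega p F n | NearRoot ε z.1 z.2}) /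
        haar p F E (Metric.closedBall 0 ε) := by
    intro P
    rw [← haar_nearRoot hU1 hε hU P, Measure.restrict_apply' hUm, Set.inter_comm]
    rfl
  simp only [h5]
  simp only [rootDensity, div_eq_mul_inv]
  rw [lintegral_mul_const' _ _ (ENNReal.inv_ne_top.2 h3),
    lintegral_mul_const' _ _ (ENNReal.inv_ne_top.2 h3)]
  congr 1
  exact h2.symm.trans h1

end Evaluation

/-! ### Almost every polynomial has only simple roots. -/

section NullSets

variable {p : ℕ} [Fact p.Prime] {F : Type*} [NormedField F] [NormedAlgebra ℚ_[p] F]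
  [FiniteDimensional ℚ_[p] F] [MeasurableSpace F] [BorelSpace F]
  {E : Type*} [NormedField E] [NormedAlgebra F E] [FiniteDimensional F E]

theorem ev_single_zero {m : ℕ} (x : E) (c : intRing p F) :
    ev x (fun i : Fin (m + 1) => c * (Pi.single 0 1 : Fin (m + 1) → intRing p F) i) =
      algebraMap F E c := by
  rw [ev_eq_sum, Finset.sum_eq_single 0]
  · simp [Algebra.smul_def]
    rfl
  · intro b _ hb
    simp [hb]
  · simp

theorem dv_single_zero {m : ℕ} (x : E) (c : intRing p F) :
    dv x (fun i : Fin (m + 1) => c * (Pi.single 0 1 : Fin (m + 1) → intRing p F) i) = 0 := by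
  rw [dv_eq_sum]
  refine Finset.sum_eq_zero fun b _ => ?_
  rcases eq_or_ne b 0 with rfl | hb
  · simp
  · simp [hb]

theorem measure_ev_eq_zero (m : ℕ) (x : E) :
    coeffMeasure p F (m + 1) {P | ev x P = 0} = 0 := by
  refine coeffMeasure_eq_zero p F ?_ (Pi.single 0 1) fun P => ?_
  · exact (isClosed_eq (continuous_ev.comp (Continuous.prodMk_right x))
      continuous_const).measurableSet
  · refine Set.Subsingleton.countable fun c hc d hd => ?_
    simp only [Set.mem_ofPred_eq, ev_add, ev_single_zero] at hc hd
    have : algebraMap F E c = algebraMap F E d := add_left_cancel (hc.trans hd.symm)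
    exact Subtype.ext ((algebraMap F E).injective this)

/-- Almost surely the coefficient of `X`, which exists since `1 ≤ n`, is nonzero, so `P' ≠ 0`.
Adding a constant `c` to `P` does not change `P'`, and `P + c` has a multiple root only if `c =
-P(x)` for one of the finitely many roots `x` of `P'`. Each line in the direction of the constant
coefficient thus meets the bad set in a countable set. -/
theorem ae_simple_roots {n : ℕ} (hn : 1 ≤ n) (E : Type*) [NormedField E] [NormedAlgebra F E]
    [FiniteDimensional F E] :
    ∀ᵐ P ∂(polyMeasure p F n), ∀ x : E, ev x P = 0 → dv x P ≠ 0 := by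
  classical
  haveI := properSpace_ext p F E
  haveI := charZero_base p F
  haveI : CharZero E := charZero_of_injective_algebraMap (algebraMap F E).injective
  let one : Fin (n + 1) := ⟨1, by omega⟩
  have h1 : coeffMeasure p F (n + 1) {P | P one = 0} = 0 := by
    refine coeffMeasure_eq_zero p F ?_ (Pi.single one 1) fun P => ?_
    · exact (isClosed_eq (continuous_apply one) continuous_const).measurableSet
    · refine Set.Subsingleton.countable fun c hc d hd => ?_
      simp only [Set.mem_ofPred_eq, Pi.add_apply, Pi.single_eq_same, mul_one] at hc hd
      exact add_left_cancel (hc.trans hd.symm)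
  let T : Set (E × (Fin (n + 1) → intRing p F)) := {z | ev z.1 z.2 = 0 ∧ dv z.1 z.2 = 0}
  have hT : IsClosed T :=
    (isClosed_eq continuous_ev continuous_const).inter (isClosed_eq continuous_dv continuous_const)
  have h2 : coeffMeasure p F (n + 1) ({P | ∃ x ∈ Set.univ, (x, P) ∈ T} ∩ {P | P one = 0}ᶜ) = 0 := by
    refine coeffMeasure_eq_zero p F ?_ (Pi.single 0 1) fun P => ?_
    · refine (measurableSet_exists_mem isOpen_univ hT).inter (MeasurableSet.compl ?_)
      exact (isClosed_eq (continuous_apply one) continuous_const).measurableSet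
    · have hone : one ≠ 0 := fun h => by
        have := congrArg Fin.val h
        simp [one] at this
      by_cases hP : P one = 0
      · refine Set.countable_empty.mono fun c hc => ?_
        refine hc.2 ?_
        simp [hP, hone]
      · have hd : (polyOf P).derivative ≠ 0 := by
          intro h0
          have h3 := congrArg (fun f => f.coeff 0) h0
          simp only [coeff_derivative, coeff_zero] at h3
          have h4 : (polyOf P).coeff (0 + 1) = P one := coeff_polyOf_fin P one
          rw [h4] at h3
          simp at h3
          exact hP h3
        let f := (polyOf P).derivative.map (algebraMap (intRing p F) E)
        have hf : f ≠ 0 := by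
          rw [Polynomial.map_ne_zero_iff]
          · exact hd
          · intro a b hab
            exact Subtype.ext ((algebraMap F E).injective hab)
        have hfin : (f.roots.toFinset : Set E).Finite := Finset.finite_toSet _
        have hc : Set.Countable ((fun x : E => -ev x P) '' (f.roots.toFinset : Set E)) :=
          (hfin.image _).countable
        refine Set.Countable.mono ?_ (hc.preimage_of_injOn (f := fun c : intRing p F =>
          algebraMap F E c) ?_)
        · rintro c ⟨⟨x, -, hx1, hx2⟩, -⟩
          simp only [ev_add, ev_single_zero, dv_add, dv_single_zero, add_zero] at hx1 hx2
          refine ⟨x, ?_, (eq_neg_of_add_eq_zero_right hx1).symm⟩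
          simp only [Finset.mem_coe, Multiset.mem_toFinset, mem_roots hf, IsRoot.def, f]
          rw [eval_map_algebraMap]
          exact hx2
        · intro a _ b _ hab
          exact Subtype.ext ((algebraMap F E).injective hab)
  rw [ae_iff]
  refine measure_mono_null ?_ (measure_union_null h1 h2)
  intro P hP
  simp only [Set.mem_ofPred_eq, not_forall, not_not] at hP
  obtain ⟨x, hx1, hx2⟩ := hP
  by_cases h : P one = 0
  · exact Or.inl h
  · exact Or.inr ⟨⟨x, trivial, hx1, hx2⟩, h⟩

end NullSets

/-! ### The limit density at an integral generator. -/

section Limit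

variable {p : ℕ} [Fact p.Prime] {F : Type*} [NormedField F] [NormedAlgebra ℚ_[p] F]
  [FiniteDimensional ℚ_[p] F] [MeasurableSpace F] [BorelSpace F]
  {E : Type*} [NormedField E] [NormedAlgebra F E] [FiniteDimensional F E]
  [MeasurableSpace E] [BorelSpace E]

theorem ev_mem_adjoinGroup {m : ℕ} (x : E) (A : Fin m → intRing p F) :
    ev x A ∈ adjoinGroup p F x :=
  aeval_mem_adjoin_singleton (intRing p F) x

theorem exists_ev_eq {x : E} (hx : ‖x‖ ≤ 1) (h : Algebra.adjoin F {x} = ⊤) {y : E}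
    (hy : y ∈ adjoinGroup p F x) :
    ∃ A : Fin (Module.finrank F E) → intRing p F, ev x A = y := by
  have hy' : y ∈ (adjoinGroup p F x : Set E) := hy
  rw [← span_powers p F hx h, SetLike.mem_coe, Submodule.mem_span_range_iff_exists_fun] at hy'
  obtain ⟨A, hA⟩ := hy'
  exact ⟨A, (ev_eq_sum x A).trans hA⟩

/-- The value at `x` of a random polynomial of degree less than `[E : F]` is uniformly distributed
in `O_F[x]`. -/
theorem coeffMeasure_ev_mem {x : E} (hx : ‖x‖ ≤ 1) (h : Algebra.adjoin F {x} = ⊤) {S : Set E}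
    (hS : MeasurableSet S) :
    coeffMeasure p F (Module.finrank F E) {A | ev x A ∈ S} =
      intIndex p F E x * haar p F E (S ∩ adjoinGroup p F x) := by
  haveI := isUltrametricDist_ext p F E
  haveI := properSpace_ext p F E
  let L : AddSubgroup E := adjoinGroup p F x
  have hLo : IsOpen (L : Set E) := (adjoinGroup_properties p F hx h).1
  have hidx := intIndex_mul_haar p F hx h
  let ψ : (Fin (Module.finrank F E) → intRing p F) →+ L :=
    { toFun := fun A => ⟨ev x A, ev_mem_adjoinGroup x A⟩
      map_zero' := Subtype.ext (by simp [ev_eq_sum])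
      map_add' := fun A B => Subtype.ext (ev_add x A B) }
  have hψ : Continuous ψ :=
    (continuous_ev.comp (Continuous.prodMk_right x)).subtype_mk _
  have hψs : Function.Surjective ψ := fun y => by
    obtain ⟨A, hA⟩ := exists_ev_eq hx h y.2
    exact ⟨A, Subtype.ext hA⟩
  haveI : CompactSpace L := by
    rw [← isCompact_univ_iff, ← hψs.range_eq]
    exact isCompact_range hψ
  haveI : LocallyCompactSpace L := inferInstance
  have happ : ∀ s : Set L, (haar p F E).comap (Subtype.val : L → E) s =
      haar p F E (Subtype.val '' s) := fun s =>
    (MeasurableEmbedding.subtype_coe hLo.measurableSet).comap_apply _ _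
  haveI : ((haar p F E).comap (Subtype.val : L → E)).IsAddHaarMeasure :=
    Measure.IsAddHaarMeasure.comap (mH := inferInstance) (haar p F E) (f := L.subtype)
      hLo.isOpenEmbedding_subtypeVal
  have hidx0 : (intIndex p F E x : ℝ≥0∞) ≠ 0 := fun h0 => by simp [h0] at hidx
  haveI : ((intIndex p F E x : ℝ≥0∞) •
      (haar p F E).comap (Subtype.val : L → E)).IsAddHaarMeasure :=
    Measure.IsAddHaarMeasure.smul _ hidx0 (ENNReal.natCast_ne_top _)
  haveI : IsProbabilityMeasure ((intIndex p F E x : ℝ≥0∞) •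
      (haar p F E).comap (Subtype.val : L → E)) := ⟨by
    rw [Measure.smul_apply, happ, Set.image_univ, Subtype.range_coe, smul_eq_mul]
    exact hidx⟩
  haveI := Measure.isAddHaarMeasure_map_of_isFiniteMeasure
    (coeffMeasure p F (Module.finrank F E)) ψ hψ hψs
  haveI := Measure.isProbabilityMeasure_map (μ := coeffMeasure p F (Module.finrank F E))
    hψ.measurable.aemeasurable
  -- Both are Haar probability measures on the compact group `O_F[x]`: one is the image of the
  -- uniform measure under a surjective homomorphism, the other is ambient Haar measure rescaled by
  -- the index.
  have heq := Measure.isAddHaarMeasure_eq_of_isProbabilityMeasure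
    ((coeffMeasure p F (Module.finrank F E)).map ψ)
    ((intIndex p F E x : ℝ≥0∞) • (haar p F E).comap (Subtype.val : L → E))
  have h1 := congrArg (fun ν : Measure L => ν (Subtype.val ⁻¹' S)) heq
  rw [Measure.map_apply hψ.measurable (hS.preimage measurable_subtype_coe), Measure.smul_apply,
    happ, smul_eq_mul] at h1
  have himg : (Subtype.val '' (Subtype.val ⁻¹' S : Set L) : Set E) = S ∩ L :=
    (Subtype.image_preimage_coe (L : Set E) S).trans (Set.inter_comm _ _)
  exact h1.trans (congrArg (fun t => (intIndex p F E x : ℝ≥0∞) * haar p F E t) himg)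

/-- Since `1, x, …, x^(r-1)` is a basis, with `r = [E : F]`, the value `A'(x)` is the image of
`A(x)` under an `F`-linear map of `E`, which is bounded. -/
theorem exists_norm_dv_le {x : E} (h : Algebra.adjoin F {x} = ⊤) :
    ∃ C : ℝ, 0 < C ∧ ∀ A : Fin (Module.finrank F E) → intRing p F, ‖dv x A‖ ≤ C * ‖ev x A‖ := by
  haveI := properSpace_base p F
  letI := nontriviallyNormed p F
  obtain ⟨-, b, hb⟩ := exists_powerBasis h
  let d : E →ₗ[F] E := b.constr F fun i => (i : ℕ) * x ^ ((i : ℕ) - 1)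
  have hd : ∀ A : Fin (Module.finrank F E) → intRing p F, d (ev x A) = dv x A := by
    intro A
    rw [ev_eq_sum, dv_eq_sum, map_sum]
    refine Finset.sum_congr rfl fun i _ => ?_
    rw [Subring.smul_def, Subring.smul_def, map_smul, ← hb, Module.Basis.constr_basis]
  obtain ⟨C, hC, hle⟩ := (LinearMap.toContinuousLinearMap d).bound
  exact ⟨C, hC, fun A => by rw [← hd]; exact hle _⟩

/-- The distribution of approximate roots, for polynomials with given quotient by the minimal
polynomial of `x`. -/
noncomputable def remDensity (p : ℕ) [Fact p.Prime] (F : Type*) [NormedField F]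
    [NormedAlgebra ℚ_[p] F] [FiniteDimensional ℚ_[p] F] [MeasurableSpace F] [BorelSpace F]
    {E : Type*} [NormedField E] [NormedAlgebra F E] [FiniteDimensional F E]
    [MeasurableSpace E] [BorelSpace E] (ε : ℝ) (x w : E) : ℝ≥0∞ :=
  coeffMeasure p F (Module.finrank F E)
    {A | ‖ev x A‖ ≤ ε * ‖dv x A + w‖ ∧ ε < ‖dv x A + w‖} / haar p F E (Metric.closedBall 0 ε)

/-- The derivative has norm at most `1`, so the condition forces `A(x)` into the ball of radius `ε`,
and `A(x)` is uniform in `O_F[x]`. The bound is uniform in `ε` and `w` and serves as the dominating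
function. -/
theorem remDensity_le {x : E} (hx : ‖x‖ ≤ 1) (h : Algebra.adjoin F {x} = ⊤) {ε : ℝ} (hε : 0 < ε)
    {w : E} (hw : ‖w‖ ≤ 1) : remDensity p F ε x w ≤ intIndex p F E x := by
  haveI := isUltrametricDist_ext p F E
  obtain ⟨h1, h2⟩ := haar_closedBall_ne (p := p) (F := F) (E := E) hε
  refine (ENNReal.div_le_iff h1 h2).2 ?_
  calc _ ≤ coeffMeasure p F (Module.finrank F E) {A | ev x A ∈ Metric.closedBall 0 ε} := by
        refine measure_mono fun A hA => ?_
        rw [Set.mem_ofPred_eq, mem_closedBall_zero_iff]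
        refine hA.1.trans (mul_le_of_le_one_right hε.le ?_)
        exact (IsUltrametricDist.norm_add_le_max _ _).trans (max_le (norm_dv_le_one hx A) hw)
    _ ≤ _ := by
        rw [coeffMeasure_ev_mem hx h measurableSet_closedBall]
        gcongr
        exact Set.inter_subset_left

/-- The function is in fact constant for small `ε`: there the condition reads `‖A(x)‖ ≤ ε‖w‖`, a
ball inside `O_F[x]` whose volume is `modulus w` times that of the ball of radius `ε`. -/
theorem tendsto_remDensity {x : E} (hx : ‖x‖ ≤ 1) (h : Algebra.adjoin F {x} = ⊤)
    {w : E} (hw : ‖w‖ ≤ 1) (hw0 : w ≠ 0) :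
    Filter.Tendsto (fun ε => remDensity p F ε x w) (nhdsWithin 0 (Set.Ioi 0))
      (nhds (intIndex p F E x * ENNReal.ofReal (modulus p F E w))) := by
  haveI := isUltrametricDist_ext p F E
  have hwpos : 0 < ‖w‖ := norm_pos_iff.2 hw0
  obtain ⟨C, hC, hdv⟩ := exists_norm_dv_le (p := p) h
  obtain ⟨δ, hδ, hball⟩ := Metric.isOpen_iff.1 (adjoinGroup_properties p F hx h).1 0
    (adjoinGroup p F x).zero_mem
  -- Three thresholds: `ε < ‖w‖` yields the second inequality of the condition, `ε < ‖w‖ / C` makes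
  -- `A'(x)` smaller than `w`, and `ε < δ` puts the ball inside `O_F[x]`.
  have hev : ∀ᶠ ε : ℝ in nhdsWithin 0 (Set.Ioi 0), 0 < ε ∧ ε < ‖w‖ ∧ ε < ‖w‖ / C ∧ ε < δ := by
    refine Filter.Eventually.and self_mem_nhdsWithin (Filter.Eventually.and ?_ (Filter.Eventually.and ?_ ?_))
    · exact nhdsWithin_le_nhds (eventually_lt_nhds hwpos)
    · exact nhdsWithin_le_nhds (eventually_lt_nhds (div_pos hwpos hC))
    · exact nhdsWithin_le_nhds (eventually_lt_nhds hδ)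
  refine tendsto_const_nhds.congr' ?_
  filter_upwards [hev] with ε ⟨hε, hε1, hε2, hε3⟩
  obtain ⟨h1, h2⟩ := haar_closedBall_ne (p := p) (F := F) (E := E) hε
  rw [remDensity, ENNReal.eq_div_iff h1 h2]
  have hnorm : ∀ A : Fin (Module.finrank F E) → intRing p F, ‖ev x A‖ ≤ ε →
      ‖dv x A + w‖ = ‖w‖ := by
    intro A hA
    refine norm_eq_of_norm_sub_lt ?_
    rw [add_sub_cancel_right]
    refine (hdv A).trans_lt ?_
    calc C * ‖ev x A‖ ≤ C * ε := by gcongr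
      _ < ‖w‖ := by rwa [lt_div_iff₀' hC] at hε2
  have hset : {A : Fin (Module.finrank F E) → intRing p F |
      ‖ev x A‖ ≤ ε * ‖dv x A + w‖ ∧ ε < ‖dv x A + w‖} =
      {A | ev x A ∈ Metric.closedBall 0 (‖w‖ * ε)} := by
    ext A
    rw [Set.mem_ofPred_eq, Set.mem_ofPred_eq, mem_closedBall_zero_iff]
    constructor
    · rintro ⟨hA, -⟩
      have hle : ‖dv x A + w‖ ≤ 1 :=
        (IsUltrametricDist.norm_add_le_max _ _).trans (max_le (norm_dv_le_one hx A) hw)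
      rw [hnorm A (hA.trans (mul_le_of_le_one_right hε.le hle))] at hA
      rwa [mul_comm]
    · intro hA
      rw [hnorm A (hA.trans (mul_le_of_le_one_left hε.le hw)), mul_comm]
      exact ⟨hA, hε1⟩
  have hsub : Metric.closedBall 0 (‖w‖ * ε) ⊆ (adjoinGroup p F x : Set E) := by
    refine (Metric.closedBall_subset_ball ?_).trans hball
    exact (mul_le_of_le_one_left hε.le hw).trans_lt hε3
  rw [hset, coeffMeasure_ev_mem hx h measurableSet_closedBall, Set.inter_eq_left.2 hsub,
    haar_closedBall_mul p F w hw0, mul_comm, mul_assoc]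
  rfl

/-- The minimal polynomial of `x` over `O_F`, its derivative at `x`. -/
theorem exists_minpoly {x : E} (hx : ‖x‖ ≤ 1) (h : Algebra.adjoin F {x} = ⊤) :
    ∃ Z : (intRing p F)[X], Z.Monic ∧ Z.natDegree = Module.finrank F E ∧ aeval x Z = 0 ∧
      aeval x Z.derivative = aeval x (minpoly F x).derivative := by
  have hi := isIntegral_intRing p F hx
  refine ⟨minpoly (intRing p F) x, minpoly.monic hi, ?_, minpoly.aeval _ x, ?_⟩
  · rw [← (exists_powerBasis h).1, minpoly_intRing p F hx, (minpoly.monic hi).natDegree_map]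
  · rw [minpoly_intRing p F hx, derivative_map, aeval_map_algebraMap]

theorem norm_ev_le_one {m : ℕ} {x : E} (hx : ‖x‖ ≤ 1) (P : Fin m → intRing p F) : ‖ev x P‖ ≤ 1 := by
  haveI := isUltrametricDist_ext p F E
  rw [← eval_map_polyOf]
  exact (hasIntegralCoeffs_map P).norm_eval_le_one hx

theorem norm_aeval_derivative_le_one {x : E} (hx : ‖x‖ ≤ 1) (Z : (intRing p F)[X]) :
    ‖aeval x Z.derivative‖ ≤ 1 := by
  have h1 : polyOf (fun i : Fin (Z.natDegree + 1) => Z.coeff i) = Z :=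
    polyOf_coeff ((degree_le_natDegree).trans_lt (by exact_mod_cast Nat.lt_succ_self _))
  have h2 := norm_dv_le_one hx (fun i : Fin (Z.natDegree + 1) => Z.coeff i)
  rwa [dv, h1] at h2

/-- With `P = A + ZQ` and `Z(x) = 0`, one has `P(x) = A(x)` and `P'(x) = A'(x) + Z'(x)Q(x)`. Since
`A` and `Q` are independent and uniform, conditioning on `Q` leaves `remDensity` at `w = Z'(x)Q(x)`.
-/
theorem rootDensity_eq_lintegral {x : E} (hx : ‖x‖ ≤ 1) (h : Algebra.adjoin F {x} = ⊤) {n : ℕ}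
    (hn : Module.finrank F E ≤ n) (ε : ℝ) (hε : 0 < ε) :
    rootDensity p F E n ε x = ∫⁻ Q : Omega p F (n - Module.finrank F E),
      remDensity p F ε x (aeval x (minpoly F x).derivative * ev x Q)
        ∂(polyMeasure p F (n - Module.finrank F E)) := by
  obtain ⟨Z, hZm, hZd, hZ0, hZ'⟩ := exists_minpoly (p := p) hx h
  set r := Module.finrank F E with hr
  -- The `n + 1` coefficients of `P` split into `r` for the remainder and `n - r + 1` for a quotient
  -- of degree at most `n - r`.
  have hmap := map_divMap p F hZm (r := r) (m := n - r + 1) (n := n + 1) hZd (by omega) (by omega)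
  have hφ : Measurable (divMap Z r (n - r + 1) (n + 1)) := (continuous_divMap Z _ _ _).measurable
  have hm : MeasurableSet {P : Omega p F n | NearRoot ε x P} :=
    (measurableSet_nearRoot ε).preimage measurable_prodMk_left
  have hev : ∀ AQ : (Fin r → intRing p F) × (Fin (n - r + 1) → intRing p F),
      ev x (divMap Z r (n - r + 1) (n + 1) AQ) = ev x AQ.1 := by
    intro AQ
    rw [ev, polyOf_divMap hZd (by omega), map_add, map_mul, hZ0, zero_mul, add_zero]
    rfl
  have hdv : ∀ AQ : (Fin r → intRing p F) × (Fin (n - r + 1) → intRing p F),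
      dv x (divMap Z r (n - r + 1) (n + 1) AQ) =
        dv x AQ.1 + aeval x (minpoly F x).derivative * ev x AQ.2 := by
    intro AQ
    rw [dv, polyOf_divMap hZd (by omega), derivative_add, derivative_mul, map_add, map_add,
      map_mul, map_mul, hZ0, zero_mul, add_zero, hZ']
    rfl
  obtain ⟨h1, h2⟩ := haar_closedBall_ne (p := p) (F := F) (E := E) hε
  simp only [rootDensity, remDensity, div_eq_mul_inv]
  rw [lintegral_mul_const' _ _ (ENNReal.inv_ne_top.2 h1)]
  congr 1
  have h3 : polyMeasure p F n {P : Omega p F n | NearRoot ε x P} =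
      ((coeffMeasure p F r).prod (coeffMeasure p F (n - r + 1)))
        (divMap Z r (n - r + 1) (n + 1) ⁻¹' {P : Omega p F n | NearRoot ε x P}) := by
    rw [← Measure.map_apply hφ hm, hmap]
    rfl
  rw [h3, Measure.prod_apply_symm (hφ hm)]
  refine lintegral_congr fun Q => ?_
  congr 1
  ext A
  simp only [Set.mem_preimage, Set.mem_ofPred_eq, NearRoot, hev, hdv]
  exact Iff.rfl

theorem measurable_remDensity (ε : ℝ) (x : E) : Measurable (remDensity p F ε x) := by
  haveI := properSpace_ext p F E
  refine Measurable.div_const ?_ _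
  have hd : Continuous fun z : (Fin (Module.finrank F E) → intRing p F) × E => dv x z.1 :=
    continuous_dv.comp (continuous_const.prodMk continuous_fst)
  have he : Continuous fun z : (Fin (Module.finrank F E) → intRing p F) × E => ev x z.1 :=
    continuous_ev.comp (continuous_const.prodMk continuous_fst)
  have h1 : Measurable fun z : (Fin (Module.finrank F E) → intRing p F) × E => ‖ev x z.1‖ :=
    he.norm.measurable
  have h2 : Measurable fun z : (Fin (Module.finrank F E) → intRing p F) × E =>
      ‖dv x z.1 + z.2‖ := (hd.add continuous_snd).norm.measurable
  exact measurable_measure_prodMk_right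
    ((measurableSet_le h1 (h2.const_mul ε)).inter (measurableSet_lt measurable_const h2))

theorem norm_derivative_mul_ev_le_one {x : E} (hx : ‖x‖ ≤ 1) (h : Algebra.adjoin F {x} = ⊤) {m : ℕ}
    (Q : Fin m → intRing p F) : ‖aeval x (minpoly F x).derivative * ev x Q‖ ≤ 1 := by
  obtain ⟨Z, -, -, -, hZ'⟩ := exists_minpoly (p := p) hx h
  rw [← hZ', norm_mul]
  exact mul_le_one₀ (norm_aeval_derivative_le_one hx Z) (norm_nonneg _) (norm_ev_le_one hx Q)

theorem aeval_derivative_minpoly_ne_zero (p : ℕ) [Fact p.Prime] {F : Type*} [NormedField F]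
    [NormedAlgebra ℚ_[p] F] {E : Type*} [NormedField E] [NormedAlgebra F E] [FiniteDimensional F E]
    (x : E) : aeval x (minpoly F x).derivative ≠ 0 := by
  haveI := charZero_base p F
  exact (Algebra.IsSeparable.isSeparable F x).aeval_derivative_ne_zero (minpoly.aeval F x)

theorem rootDensity_le {x : E} (hx : ‖x‖ ≤ 1) (h : Algebra.adjoin F {x} = ⊤) {n : ℕ}
    (hn : Module.finrank F E ≤ n) {ε : ℝ} (hε : 0 < ε) :
    rootDensity p F E n ε x ≤ intIndex p F E x := by
  rw [rootDensity_eq_lintegral hx h hn ε hε]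
  calc _ ≤ ∫⁻ _ : Omega p F (n - Module.finrank F E), (intIndex p F E x : ℝ≥0∞)
        ∂(polyMeasure p F (n - Module.finrank F E)) :=
        lintegral_mono fun Q => remDensity_le hx h hε (norm_derivative_mul_ev_le_one hx h Q)
    _ = _ := by simp

/-- Dominated convergence in `Q`. The pointwise limit needs `w ≠ 0`: separability gives `Z'(x) ≠ 0`,
and `Q(x) ≠ 0` almost surely. -/
theorem tendsto_rootDensity {x : E} (hx : ‖x‖ ≤ 1) (h : Algebra.adjoin F {x} = ⊤) {n : ℕ}
    (hn : Module.finrank F E ≤ n) :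
    Filter.Tendsto (fun ε => rootDensity p F E n ε x) (nhdsWithin 0 (Set.Ioi 0))
      (nhds (∫⁻ Q : Omega p F (n - Module.finrank F E), intIndex p F E x *
        ENNReal.ofReal (modulus p F E (aeval x (minpoly F x).derivative * ev x Q))
        ∂(polyMeasure p F (n - Module.finrank F E)))) := by
  haveI := properSpace_ext p F E
  have hev : ∀ᶠ ε : ℝ in nhdsWithin 0 (Set.Ioi 0), 0 < ε := self_mem_nhdsWithin
  refine Filter.Tendsto.congr' (hev.mono fun ε hε => (rootDensity_eq_lintegral hx h hn ε hε).symm) ?_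
  refine tendsto_lintegral_filter_of_dominated_convergence (fun _ => (intIndex p F E x : ℝ≥0∞))
    (Filter.Eventually.of_forall fun ε => ?_) (hev.mono fun ε hε => ?_) ?_ ?_
  · refine (measurable_remDensity ε x).comp (Measurable.const_mul ?_ _)
    exact (continuous_ev.comp (Continuous.prodMk_right x)).measurable
  · exact Filter.Eventually.of_forall fun Q =>
      remDensity_le hx h hε (norm_derivative_mul_ev_le_one hx h Q)
  · simp
  · have hne : ∀ᵐ Q : Omega p F (n - Module.finrank F E)
        ∂(polyMeasure p F (n - Module.finrank F E)), ev x Q ≠ 0 := by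
      rw [ae_iff]
      simp only [not_not]
      exact measure_ev_eq_zero (p := p) (F := F) (n - Module.finrank F E) x
    filter_upwards [hne] with Q hQ
    exact tendsto_remDensity hx h (norm_derivative_mul_ev_le_one hx h Q)
      (mul_ne_zero (aeval_derivative_minpoly_ne_zero p x) hQ)

theorem integrable_modulus_ev (x : E) (m : ℕ) :
    Integrable (fun Q : Omega p F m => modulus p F E (ev x Q)) (polyMeasure p F m) := by
  haveI := properSpace_ext p F E
  have hc : Continuous fun Q : Omega p F m => modulus p F E (ev x Q) :=
    (continuous_modulus p F).comp (continuous_ev.comp (Continuous.prodMk_right x))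
  exact hc.integrable_of_hasCompactSupport (HasCompactSupport.of_compactSpace _)

/-- The density of roots at integral elements. -/
noncomputable def intDensity (p : ℕ) [Fact p.Prime] (F : Type*) [NormedField F]
    [NormedAlgebra ℚ_[p] F] [FiniteDimensional ℚ_[p] F] [MeasurableSpace F] [BorelSpace F]
    (E : Type*) [NormedField E] [NormedAlgebra F E] [FiniteDimensional F E] (n : ℕ) (x : E) : ℝ :=
  pnorm p F (discr p F E) / (intIndex p F E x : ℝ) *
    ∫ Q : Omega p F (n - Module.finrank F E),
      pnorm p F (aeval x (toPoly p F Q)) ^ Module.finrank F E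
        ∂(polyMeasure p F (n - Module.finrank F E))

theorem intDensity_nonneg (n : ℕ) (x : E) : 0 ≤ intDensity p F E n x :=
  mul_nonneg (div_nonneg (pnorm_nonneg p _) (Nat.cast_nonneg _))
    (integral_nonneg fun _ => pow_nonneg (pnorm_nonneg p _) _)

theorem lintegral_eq_intDensity {x : E} (hx : ‖x‖ ≤ 1) (h : Algebra.adjoin F {x} = ⊤) (n : ℕ) :
    ∫⁻ Q : Omega p F (n - Module.finrank F E), intIndex p F E x *
        ENNReal.ofReal (modulus p F E (aeval x (minpoly F x).derivative * ev x Q))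
        ∂(polyMeasure p F (n - Module.finrank F E)) = ENNReal.ofReal (intDensity p F E n x) := by
  set w := aeval x (minpoly F x).derivative
  have h1 : ∀ Q : Omega p F (n - Module.finrank F E), (intIndex p F E x : ℝ≥0∞) *
      ENNReal.ofReal (modulus p F E (w * ev x Q)) =
      ENNReal.ofReal (intIndex p F E x * modulus p F E w * modulus p F E (ev x Q)) := by
    intro Q
    rw [← ENNReal.ofReal_natCast, ← ENNReal.ofReal_mul (Nat.cast_nonneg _), modulus_mul, mul_assoc]
  simp only [h1]
  rw [← ofReal_integral_eq_lintegral_ofReal, integral_const_mul]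
  · rw [intDensity, ← intIndex_mul_pow p F hx h]
    simp only [aeval_toPoly]
    rfl
  · exact (integrable_modulus_ev x _).const_mul _
  · exact Filter.Eventually.of_forall fun Q => mul_nonneg
      (mul_nonneg (Nat.cast_nonneg _) (modulus_nonneg p F _)) (modulus_nonneg p F _)

end Limit

/-! ### Expected number of integral generating roots. -/

theorem encard_iUnion_of_monotone {α : Type*} {S : ℕ → Set α} (hS : Monotone S) :
    (((⋃ k, S k).encard : ℕ∞) : ℝ≥0∞) = ⨆ k, ((S k).encard : ℝ≥0∞) := by
  refine le_antisymm (encard_le_of_forall_finset fun t ht => ?_) (iSup_le fun k => ?_)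
  · obtain ⟨k, hk⟩ := Directed.exists_mem_subset_of_finset_subset_biUnion hS.directed_le ht
    refine le_trans ?_ (le_iSup _ k)
    have := Set.encard_le_encard hk
    rw [Set.encard_coe_eq_coe_finsetCard] at this
    simpa using ENat.toENNReal_le.2 this
  · exact ENat.toENNReal_le.2 (Set.encard_le_encard (Set.subset_iUnion S k))

section Expectation

variable {p : ℕ} [Fact p.Prime] {F : Type*} [NormedField F] [NormedAlgebra ℚ_[p] F]
  {E : Type*} [NormedField E] [NormedAlgebra F E]

/-- The number of roots in `U`. -/
noncomputable def rootCount (U : Set E) {n : ℕ} (P : Omega p F n) : ℝ≥0∞ :=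
  ({x | x ∈ U ∧ ev x P = 0}.encard : ℝ≥0∞)

variable [FiniteDimensional ℚ_[p] F] [FiniteDimensional F E]

theorem measurable_rootCount [MeasurableSpace F] [BorelSpace F] {U : Set E} (hU : IsOpen U)
    (n : ℕ) : Measurable (rootCount U : Omega p F n → ℝ≥0∞) := by
  haveI := properSpace_ext p F E
  exact measurable_encard_fiber hU (isClosed_eq continuous_ev continuous_const)

theorem rootCount_union {U V : Set E} (h : Disjoint U V) {n : ℕ} (P : Omega p F n) :
    rootCount (U ∪ V) P = rootCount U P + rootCount V P := by
  have h1 : {x | x ∈ U ∪ V ∧ ev x P = 0} = {x | x ∈ U ∧ ev x P = 0} ∪ {x | x ∈ V ∧ ev x P = 0} := by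
    ext x
    simp only [Set.mem_union, Set.mem_ofPred_eq]
    tauto
  rw [rootCount, h1, Set.encard_union_eq]
  · simp [rootCount]
  · exact Set.disjoint_left.2 fun x hx hx' => Set.disjoint_left.1 h hx.1 hx'.1

theorem rootCount_iUnion {U : ℕ → Set E} (hU : Monotone U) {n : ℕ} (P : Omega p F n) :
    rootCount (⋃ k, U k) P = ⨆ k, rootCount (U k) P := by
  have h1 : {x | x ∈ ⋃ k, U k ∧ ev x P = 0} = ⋃ k, {x | x ∈ U k ∧ ev x P = 0} := by
    ext x
    simp
  rw [rootCount, h1, encard_iUnion_of_monotone]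
  · rfl
  · exact fun i j hij x hx => ⟨hU hij hx.1, hx.2⟩

/-- Makes the generators of `E`, where `powDiscr` does not vanish, an open subset of `E`. -/
theorem continuous_powDiscr (p : ℕ) [Fact p.Prime] (F : Type*) [NormedField F]
    [NormedAlgebra ℚ_[p] F] [FiniteDimensional ℚ_[p] F] (E : Type*) [NormedField E]
    [NormedAlgebra F E] [FiniteDimensional F E] : Continuous (powDiscr F E) := by
  haveI := properSpace_base p F
  letI := nontriviallyNormed p F
  have ht : Continuous (Algebra.trace F E) := LinearMap.continuous_of_finiteDimensional _
  unfold powDiscr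
  simp only [Algebra.discr_def]
  refine Continuous.matrix_det (continuous_matrix fun i j => ?_)
  simp only [Algebra.traceMatrix_apply, Algebra.traceForm_apply]
  exact ht.comp (by fun_prop)

variable [MeasurableSpace F] [BorelSpace F]

theorem lintegral_rootCount_le {n : ℕ} (hn : 1 ≤ n) (U : Set E) :
    ∫⁻ P : Omega p F n, rootCount U P ∂(polyMeasure p F n) ≤ n := by
  classical
  calc _ ≤ ∫⁻ _ : Omega p F n, (n : ℝ≥0∞) ∂(polyMeasure p F n) := by
        refine lintegral_mono_ae ?_
        -- Having only simple roots excludes the zero polynomial, which has a multiple root at `0`.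
        filter_upwards [ae_simple_roots (p := p) (F := F) hn E] with P hP
        have hP0 : polyOf P ≠ 0 := by
          intro h0
          refine hP 0 ?_ ?_
          · rw [ev, h0, map_zero]
          · rw [dv, h0, derivative_zero, map_zero]
        have hinj : Function.Injective (algebraMap (intRing p F) E) := fun a b hab =>
          Subtype.ext ((algebraMap F E).injective hab)
        have hf : (polyOf P).map (algebraMap (intRing p F) E) ≠ 0 :=
          (Polynomial.map_ne_zero_iff hinj).2 hP0
        have hsub : {x | x ∈ U ∧ ev x P = 0} ⊆
            (((polyOf P).map (algebraMap (intRing p F) E)).roots.toFinset : Set E) := by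
          rintro x ⟨-, hx⟩
          simp only [Finset.mem_coe, Multiset.mem_toFinset, mem_roots hf, IsRoot.def]
          rw [eval_map_algebraMap]
          exact hx
        have h1 := Set.encard_le_encard hsub
        rw [Set.encard_coe_eq_coe_finsetCard] at h1
        have h2 : ((polyOf P).map (algebraMap (intRing p F) E)).roots.toFinset.card ≤ n := by
          refine (Multiset.toFinset_card_le _).trans ((card_roots' _).trans ?_)
          refine natDegree_map_le.trans ?_
          have := (natDegree_lt_iff_degree_lt hP0).2 (degree_polyOf_lt P)
          omega
        have h3 : {x | x ∈ U ∧ ev x P = 0}.encard ≤ (n : ℕ∞) := h1.trans (by exact_mod_cast h2)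
        have h4 := ENat.toENNReal_le.2 h3
        exact h4.trans (by simp)
    _ = n := by simp

open Classical in
/-- The density of roots, on the ring of integers. -/
noncomputable def rhoInt (p : ℕ) [Fact p.Prime] (F : Type*) [NormedField F]
    [NormedAlgebra ℚ_[p] F] [FiniteDimensional ℚ_[p] F] [MeasurableSpace F] [BorelSpace F]
    (E : Type*) [NormedField E] [NormedAlgebra F E] [FiniteDimensional F E] (n : ℕ) (x : E) :
    ℝ≥0 :=
  if ‖x‖ ≤ 1 ∧ Algebra.adjoin F {x} = ⊤ ∧ Module.finrank F E ≤ n then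
    (intDensity p F E n x).toNNReal else 0

theorem powDiscr_ne_zero_iff {p : ℕ} [Fact p.Prime] {F : Type*} [NormedField F]
    [NormedAlgebra ℚ_[p] F] {E : Type*} [NormedField E] [NormedAlgebra F E]
    [FiniteDimensional F E] {x : E} : powDiscr F E x ≠ 0 ↔ Algebra.adjoin F {x} = ⊤ := by
  haveI := charZero_base p F
  exact ⟨adjoin_eq_top_of_powDiscr_ne_zero F, powDiscr_ne_zero F⟩

theorem rhoInt_of_mem {n : ℕ} {x : E} (hx : ‖x‖ ≤ 1) (h : Algebra.adjoin F {x} = ⊤)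
    (hn : Module.finrank F E ≤ n) : rhoInt p F E n x = (intDensity p F E n x).toNNReal :=
  if_pos ⟨hx, h, hn⟩

theorem rhoInt_eq_zero {n : ℕ} {x : E}
    (h : ¬ (‖x‖ ≤ 1 ∧ Algebra.adjoin F {x} = ⊤ ∧ Module.finrank F E ≤ n)) :
    rhoInt p F E n x = 0 :=
  if_neg h

variable [MeasurableSpace E] [BorelSpace E]

theorem tendsto_rootDensity_rhoInt {x : E} (hx : ‖x‖ ≤ 1) (h : Algebra.adjoin F {x} = ⊤) {n : ℕ}
    (hn : Module.finrank F E ≤ n) :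
    Filter.Tendsto (fun ε => rootDensity p F E n ε x) (nhdsWithin 0 (Set.Ioi 0))
      (nhds (rhoInt p F E n x)) := by
  have := tendsto_rootDensity (p := p) hx h hn
  rw [lintegral_eq_intDensity hx h] at this
  rw [rhoInt_of_mem hx h hn]
  exact this

theorem tendsto_seq {ε : ℝ} (hε : 0 < ε) :
    Filter.Tendsto (fun k : ℕ => ε / (k + 1)) Filter.atTop (nhdsWithin 0 (Set.Ioi 0)) := by
  refine tendsto_nhdsWithin_iff.2 ⟨?_, Filter.Eventually.of_forall fun k => ?_⟩
  · have := (tendsto_one_div_add_atTop_nhds_zero_nat (𝕜 := ℝ)).const_mul ε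
    simpa [div_eq_mul_inv] using this
  · exact div_pos hε (by positivity)

/-- On the Borel set of integral generators, `rhoInt` is the pointwise limit of the measurable
functions `rootDensity`; elsewhere it vanishes. This avoids a direct study of how the index varies
with `x`. -/
theorem measurable_rhoInt (n : ℕ) : Measurable (rhoInt p F E n) := by
  haveI := properSpace_ext p F E
  by_cases hn : Module.finrank F E ≤ n
  · let S : Set E := {x | ‖x‖ ≤ 1 ∧ powDiscr F E x ≠ 0}
    have hS : MeasurableSet S := by
      refine (measurableSet_le measurable_norm measurable_const).inter ?_
      exact (isOpen_ne_fun (continuous_powDiscr p F E) continuous_const).measurableSet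
    have h : Measurable fun x : E => (rhoInt p F E n x : ℝ≥0∞) := by
      refine measurable_of_tendsto_metrizable
        (f := fun (k : ℕ) => S.indicator (rootDensity p F E n (1 / (k + 1))))
        (fun k => (measurable_rootDensity n _).indicator hS) (tendsto_pi_nhds.2 fun x => ?_)
      by_cases hx : x ∈ S
      · simp only [Set.indicator_of_mem hx]
        exact (tendsto_rootDensity_rhoInt hx.1 ((powDiscr_ne_zero_iff (p := p)).1 hx.2) hn).comp
          (tendsto_seq one_pos)
      · simp only [Set.indicator_of_notMem hx]
        rw [rhoInt_eq_zero]
        · exact tendsto_const_nhds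
        · exact fun h => hx ⟨h.1, (powDiscr_ne_zero_iff (p := p)).2 h.2.1⟩
    exact h.ennreal_toNNReal
  · have : rhoInt p F E n = fun _ => 0 := funext fun x => rhoInt_eq_zero fun h => hn h.2.2
    rw [this]
    exact measurable_const

/-- Apply the formula at radius `ε/(k+1)` and let `k → ∞`. Monotone convergence applies to the
counts, which exhaust all roots once these are simple; dominated convergence applies to the
densities. -/
theorem lintegral_rootCount_of_stable {n : ℕ} (hn1 : 1 ≤ n) (hn : Module.finrank F E ≤ n)
    {U : Set E} (hU1 : ∀ x ∈ U, ‖x‖ ≤ 1) (hUm : MeasurableSet U) {ε : ℝ} (hε : 0 < ε)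
    (hU : ∀ x ∈ U, Metric.closedBall x ε ⊆ U) {c : ℝ} (hc : 0 < c)
    (hUc : ∀ x ∈ U, c ≤ pnorm p F (powDiscr F E x)) :
    ∫⁻ P : Omega p F n, rootCount U P ∂(polyMeasure p F n) =
      ∫⁻ x in U, rhoInt p F E n x ∂(haar p F E) := by
  have hpos : ∀ k : ℕ, 0 < ε / (k + 1) := fun k => div_pos hε (by positivity)
  have hanti : ∀ k l : ℕ, k ≤ l → ε / (l + 1) ≤ ε / (k + 1) := fun k l hkl => by gcongr
  have hle : ∀ k : ℕ, ε / (k + 1) ≤ ε := fun k => by simpa using hanti 0 k (Nat.zero_le k)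
  have hUk : ∀ k : ℕ, ∀ x ∈ U, Metric.closedBall x (ε / (k + 1)) ⊆ U := fun k x hx =>
    (Metric.closedBall_subset_closedBall (hle k)).trans (hU x hx)
  have hnew : ∀ x ∈ U, Algebra.adjoin F {x} = ⊤ := fun x hx => by
    refine (powDiscr_ne_zero_iff (p := p)).1 fun h0 => ?_
    have := hUc x hx
    rw [h0, pnorm, norm_zero, zero_pow Module.finrank_pos.ne'] at this
    exact hc.not_ge this
  let N : ℕ → Omega p F n → ℝ≥0∞ := fun k P =>
    ({ξ | ξ ∈ U ∧ ev ξ P = 0 ∧ ε / (k + 1) < ‖dv ξ P‖}.encard : ℝ≥0∞)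
  have hNmeas : ∀ k, Measurable (N k) := by
    intro k
    haveI := sigmaFinite_haar p F E
    have hN := measurableSet_nearRoot (p := p) (F := F) (E := E) (m := n + 1) (ε / (k + 1))
    have h2 : N k = fun P => ((haar p F E).restrict U) ((fun x => (x, P)) ⁻¹'
        {z : E × Omega p F n | NearRoot (ε / (k + 1)) z.1 z.2}) /
          haar p F E (Metric.closedBall 0 (ε / (k + 1))) := by
      ext P
      rw [Measure.restrict_apply' hUm, Set.inter_comm]
      exact (haar_nearRoot hU1 (hpos k) (hUk k) P).symm
    rw [h2]
    exact (measurable_measure_prodMk_right hN).div_const _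
  have hSmono : ∀ P : Omega p F n, Monotone fun k : ℕ =>
      {ξ | ξ ∈ U ∧ ev ξ P = 0 ∧ ε / (k + 1) < ‖dv ξ P‖} := fun P k l hkl ξ hξ =>
    ⟨hξ.1, hξ.2.1, (hanti k l hkl).trans_lt hξ.2.2⟩
  have h1 : Filter.Tendsto (fun k => ∫⁻ P, N k P ∂(polyMeasure p F n)) Filter.atTop
      (nhds (∫⁻ P : Omega p F n, rootCount U P ∂(polyMeasure p F n))) := by
    refine lintegral_tendsto_of_tendsto_of_monotone (fun k => (hNmeas k).aemeasurable)
      (Filter.Eventually.of_forall fun P k l hkl =>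
        ENat.toENNReal_le.2 (Set.encard_le_encard (hSmono P hkl))) ?_
    filter_upwards [ae_simple_roots (p := p) (F := F) hn1 E] with P hP
    have h2 : rootCount U P = ⨆ k, N k P := by
      rw [rootCount, ← encard_iUnion_of_monotone (hSmono P)]
      congr 2
      ext ξ
      simp only [Set.mem_iUnion, Set.mem_ofPred_eq]
      constructor
      · rintro ⟨hξ, h0⟩
        have h3 : 0 < ‖dv ξ P‖ := norm_pos_iff.2 (hP ξ h0)
        have h4 := (tendsto_nhds_of_tendsto_nhdsWithin (tendsto_seq hε)).eventually
          (eventually_lt_nhds h3)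
        obtain ⟨k, hk⟩ := h4.exists
        exact ⟨k, hξ, h0, hk⟩
      · rintro ⟨k, hξ, h0, -⟩
        exact ⟨hξ, h0⟩
    rw [h2]
    exact tendsto_atTop_iSup fun k l hkl =>
        ENat.toENNReal_le.2 (Set.encard_le_encard (hSmono P hkl))
  have h2 : Filter.Tendsto (fun k : ℕ => ∫⁻ x in U, rootDensity p F E n (ε / (k + 1)) x ∂(haar p F E))
      Filter.atTop (nhds (∫⁻ x in U, rhoInt p F E n x ∂(haar p F E))) := by
    -- This bounds the index on `U`: its square times `pnorm (powDiscr F E x)`, which is at least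
    -- `c`, equals `pnorm` of the discriminant of `E`.
    let D := Real.sqrt (pnorm p F (discr p F E) / c)
    refine tendsto_lintegral_of_dominated_convergence (fun _ => ENNReal.ofReal D)
      (fun k => measurable_rootDensity n _) (fun k => ?_) ?_ ?_
    · refine (ae_restrict_iff' hUm).2 (Filter.Eventually.of_forall fun x hx => ?_)
      refine (rootDensity_le (hU1 x hx) (hnew x hx) hn (hpos k)).trans ?_
      rw [← ENNReal.ofReal_natCast]
      refine ENNReal.ofReal_le_ofReal (Real.le_sqrt_of_sq_le ?_)
      rw [le_div_iff₀ hc]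
      obtain ⟨h3, h4⟩ := intIndex_sq_mul p F (hU1 x hx) (hnew x hx)
      rw [← h3]
      gcongr
      exact hUc x hx
    · rw [lintegral_const, Measure.restrict_apply_univ]
      refine ENNReal.mul_ne_top ENNReal.ofReal_ne_top (ne_of_lt ?_)
      refine lt_of_le_of_lt (measure_mono (t := Metric.closedBall 0 1) fun x hx => ?_)
        (by rw [haar_closedBall_one]; exact ENNReal.one_lt_top)
      simpa using hU1 x hx
    · refine (ae_restrict_iff' hUm).2 (Filter.Eventually.of_forall fun x hx => ?_)
      exact (tendsto_rootDensity_rhoInt (hU1 x hx) (hnew x hx) hn).comp (tendsto_seq hε)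
  refine tendsto_nhds_unique h1 ?_
  have h3 : ∀ k, ∫⁻ P, N k P ∂(polyMeasure p F n) =
      ∫⁻ x in U, rootDensity p F E n (ε / (k + 1)) x ∂(haar p F E) := fun k =>
    lintegral_encard_eq_rootDensity hU1 hUm (hpos k) (hUk k) n
  simp only [h3]
  exact h2

theorem lintegral_rootCount_integral {n : ℕ} (hn1 : 1 ≤ n) (hn : Module.finrank F E ≤ n)
    {U : Set E} (hUo : IsOpen U) (hU1 : ∀ x ∈ U, ‖x‖ ≤ 1) (hU : ∀ x ∈ U, powDiscr F E x ≠ 0) :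
    ∫⁻ P : Omega p F n, rootCount U P ∂(polyMeasure p F n) =
      ∫⁻ x in U, rhoInt p F E n x ∂(haar p F E) := by
  haveI := isUltrametricDist_ext p F E
  haveI := properSpace_ext p F E
  have hpos : ∀ k : ℕ, (0 : ℝ) < 1 / (k + 1) := fun k => div_pos one_pos (by positivity)
  have hanti : ∀ k l : ℕ, k ≤ l → (1 : ℝ) / (l + 1) ≤ 1 / (k + 1) := fun k l hkl => by gcongr
  have hcont : Continuous fun x : E => pnorm p F (powDiscr F E x) :=
    (continuous_powDiscr p F E).norm.pow _
  let W : ℕ → Set E := fun k => U ∩ {x | 1 / ((k : ℝ) + 1) < pnorm p F (powDiscr F E x)}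
  have hWo : ∀ k, IsOpen (W k) := fun k => hUo.inter (isOpen_lt continuous_const hcont)
  have hWm : Monotone W := fun k l hkl x hx => ⟨hx.1, (hanti k l hkl).trans_lt hx.2⟩
  -- In an ultrametric space a ball is centred at each of its points, so `V k` is stable under balls
  -- of radius `1/(k+1)`. Inside `W k` the discriminant is bounded below, so the stable case applies
  -- to each `V k`, and these sets increase to `U`.
  let V : ℕ → Set E := fun k => {x | Metric.closedBall x (1 / ((k : ℝ) + 1)) ⊆ W k}
  have hVW : ∀ k, V k ⊆ W k := fun k x hx => hx (Metric.mem_closedBall_self (hpos k).le)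
  have hVst : ∀ k, ∀ x ∈ V k, Metric.closedBall x (1 / ((k : ℝ) + 1)) ⊆ V k := by
    intro k x hx y hy
    have : Metric.closedBall y (1 / ((k : ℝ) + 1)) = Metric.closedBall x (1 / ((k : ℝ) + 1)) :=
      (IsUltrametricDist.closedBall_eq_of_mem hy).symm
    exact this.subset.trans hx
  have hVo : ∀ k, IsOpen (V k) := fun k => Metric.isOpen_iff.2 fun x hx =>
    ⟨_, hpos k, Metric.ball_subset_closedBall.trans (hVst k x hx)⟩
  have hVm : Monotone V := fun k l hkl x hx =>
    (Metric.closedBall_subset_closedBall (hanti k l hkl)).trans (hx.trans (hWm hkl))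
  have hVU : ⋃ k, V k = U := by
    refine Set.Subset.antisymm (Set.iUnion_subset fun k x hx => (hVW k hx).1) fun x hx => ?_
    have hlim := tendsto_nhds_of_tendsto_nhdsWithin (tendsto_seq one_pos)
    obtain ⟨k, hk⟩ := (hlim.eventually
      (eventually_lt_nhds (pnorm_pos p (F := F) (hU x hx)))).exists
    obtain ⟨δ, hδ, hball⟩ := Metric.isOpen_iff.1 (hWo k) x ⟨hx, hk⟩
    obtain ⟨l, hl⟩ := (hlim.eventually (eventually_lt_nhds hδ)).exists
    refine Set.mem_iUnion.2 ⟨max k l, ?_⟩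
    refine ((Metric.closedBall_subset_ball ?_).trans hball).trans (hWm (le_max_left k l))
    exact (hanti l _ (le_max_right k l)).trans_lt hl
  have h1 : ∀ k, ∫⁻ P : Omega p F n, rootCount (V k) P ∂(polyMeasure p F n) =
      ∫⁻ x in V k, rhoInt p F E n x ∂(haar p F E) := fun k =>
    lintegral_rootCount_of_stable hn1 hn (fun x hx => hU1 x (hVW k hx).1) (hVo k).measurableSet
      (hpos k) (hVst k) (hpos k) fun x hx => (hVW k hx).2.le
  have h2 : ∫⁻ P : Omega p F n, rootCount U P ∂(polyMeasure p F n) =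
      ⨆ k, ∫⁻ P : Omega p F n, rootCount (V k) P ∂(polyMeasure p F n) := by
    rw [← lintegral_iSup (fun k => measurable_rootCount (hVo k) n)]
    · simp only [← rootCount_iUnion hVm, hVU]
    · exact fun k l hkl P => ENat.toENNReal_le.2
        (Set.encard_le_encard fun x hx => ⟨hVm hkl hx.1, hx.2⟩)
  have h3 : ∫⁻ x in U, rhoInt p F E n x ∂(haar p F E) =
      ⨆ k, ∫⁻ x in V k, rhoInt p F E n x ∂(haar p F E) := by
    rw [← hVU]
    exact setLIntegral_iUnion_of_directed _ hVm.directed_le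
  rw [h2, h3]
  simp only [h1]

/-- A root generating an extension of degree greater than `n` is not a root of a nonzero polynomial
of degree at most `n`. -/
theorem lintegral_rootCount_eq_zero {n : ℕ} (hn1 : 1 ≤ n) (hn : n < Module.finrank F E)
    {U : Set E} (hU : ∀ x ∈ U, powDiscr F E x ≠ 0) :
    ∫⁻ P : Omega p F n, rootCount U P ∂(polyMeasure p F n) = 0 := by
  rw [← lintegral_zero (α := Omega p F n) (μ := polyMeasure p F n)]
  refine lintegral_congr_ae ?_
  filter_upwards [ae_simple_roots (p := p) (F := F) hn1 E] with P hP
  have hempty : {x | x ∈ U ∧ ev x P = 0} = ∅ := by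
    refine Set.eq_empty_of_forall_notMem ?_
    rintro x ⟨hx, h0⟩
    have hf0 : toPoly p F P ≠ 0 := by
      intro hf
      rw [toPoly_eq, Polynomial.map_eq_zero_iff Subtype.val_injective] at hf
      exact hP x h0 (by rw [dv, hf, derivative_zero, map_zero])
    have h2 : (toPoly p F P).natDegree ≤ n := by
      rw [toPoly_eq]
      refine natDegree_map_le.trans ?_
      rcases eq_or_ne (polyOf P) 0 with h | h
      · simp [h]
      · have := (natDegree_lt_iff_degree_lt h).2 (degree_polyOf_lt P)
        omega
    have h3 := natDegree_le_of_dvd (minpoly.dvd F x ((aeval_toPoly x P).trans h0)) hf0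
    rw [(exists_powerBasis ((powDiscr_ne_zero_iff (p := p)).1 (hU x hx))).1] at h3
    omega
  rw [rootCount, hempty]
  simp

end Expectation

/-! ### Non-integral roots by inversion, and the full density. -/

theorem adjoin_singleton_eq_top_iff {F E : Type*} [Field F] [Field E] [Algebra F E]
    [FiniteDimensional F E] (x : E) :
    Algebra.adjoin F {x} = ⊤ ↔ IntermediateField.adjoin F {x} = ⊤ := by
  rw [← IntermediateField.adjoin_simple_toSubalgebra_of_isAlgebraic (IsAlgebraic.of_finite F x),
    ← IntermediateField.top_toSubalgebra, IntermediateField.toSubalgebra_inj]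

theorem adjoin_singleton_inv_eq_top_iff {F E : Type*} [Field F] [Field E] [Algebra F E]
    [FiniteDimensional F E] (x : E) :
    Algebra.adjoin F {x⁻¹} = ⊤ ↔ Algebra.adjoin F {x} = ⊤ := by
  have h : IntermediateField.adjoin F {x⁻¹} = IntermediateField.adjoin F {x} := by
    refine le_antisymm ?_ ?_ <;> rw [IntermediateField.adjoin_simple_le_iff]
    · exact inv_mem (IntermediateField.mem_adjoin_simple_self F x)
    · simpa using inv_mem (IntermediateField.mem_adjoin_simple_self F x⁻¹)
  rw [adjoin_singleton_eq_top_iff, adjoin_singleton_eq_top_iff, h]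

section Density

variable {p : ℕ} [Fact p.Prime] {F : Type*} [NormedField F] [NormedAlgebra ℚ_[p] F]
  [FiniteDimensional ℚ_[p] F] [MeasurableSpace F] [BorelSpace F]
  {E : Type*} [NormedField E] [NormedAlgebra F E] [FiniteDimensional F E]

open Classical in
/-- The density of roots. -/
noncomputable def rho (p : ℕ) [Fact p.Prime] (F : Type*) [NormedField F]
    [NormedAlgebra ℚ_[p] F] [FiniteDimensional ℚ_[p] F] [MeasurableSpace F] [BorelSpace F]
    (E : Type*) [NormedField E] [NormedAlgebra F E] [FiniteDimensional F E] (n : ℕ) (x : E) :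
    ℝ≥0 :=
  if ‖x‖ ≤ 1 then rhoInt p F E n x
  else (modulus p F E x ^ 2)⁻¹.toNNReal * rhoInt p F E n x⁻¹

theorem rho_of_norm_le {n : ℕ} {x : E} (hx : ‖x‖ ≤ 1) : rho p F E n x = rhoInt p F E n x :=
  if_pos hx

theorem rho_of_lt_norm {n : ℕ} {x : E} (hx : 1 < ‖x‖) :
    rho p F E n x = (modulus p F E x ^ 2)⁻¹.toNNReal * rhoInt p F E n x⁻¹ :=
  if_neg hx.not_ge

theorem rho_eq_zero {n : ℕ} {x : E} (hx : Algebra.adjoin F {x} ≠ ⊤) : rho p F E n x = 0 := by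
  rcases le_or_gt ‖x‖ 1 with h | h
  · rw [rho_of_norm_le h, rhoInt_eq_zero fun h => hx h.2.1]
  · rw [rho_of_lt_norm h, rhoInt_eq_zero, mul_zero]
    exact fun h => hx ((adjoin_singleton_inv_eq_top_iff x).1 h.2.1)

theorem ev_comp_rev {n : ℕ} (P : Omega p F n) {x : E} (hx : x ≠ 0) :
    ev x (fun i => P i.rev) = x ^ n * ev x⁻¹ P := by
  rw [ev_eq_sum, ev_eq_sum, Finset.mul_sum, ← Equiv.sum_comp Fin.revPerm]
  refine Finset.sum_congr rfl fun i _ => ?_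
  have hi : (i : ℕ) ≤ n := Nat.lt_succ_iff.1 i.2
  have h1 : ((Fin.rev i : Fin (n + 1)) : ℕ) = n - i := by
    rw [Fin.val_rev]
    omega
  rw [Fin.revPerm_apply, Fin.rev_rev, h1, mul_smul_comm, inv_pow, pow_sub₀ x hx hi]

theorem rootCount_inv {n : ℕ} {U : Set E} (hU : (0 : E) ∉ U) (P : Omega p F n) :
    rootCount U⁻¹ (fun i => P i.rev) = rootCount U P := by
  have h : {x : E | x ∈ U⁻¹ ∧ ev x (fun i => P i.rev) = 0} =
      (fun x => x⁻¹) '' {x | x ∈ U ∧ ev x P = 0} := by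
    ext x
    constructor
    · rintro ⟨hx, h0⟩
      have hx0 : x ≠ 0 := by
        rintro rfl
        rw [Set.mem_inv, inv_zero] at hx
        exact hU hx
      rw [ev_comp_rev P hx0] at h0
      exact ⟨x⁻¹, ⟨hx, (mul_eq_zero.1 h0).resolve_left (pow_ne_zero _ hx0)⟩, inv_inv x⟩
    · rintro ⟨y, ⟨hy, h0⟩, rfl⟩
      have hy0 : y ≠ 0 := fun h => hU (h ▸ hy)
      exact ⟨by simpa using hy, by rw [ev_comp_rev P (inv_ne_zero hy0), inv_inv, h0, mul_zero]⟩
  rw [rootCount, h, inv_injective.encard_image]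
  rfl

theorem isOpen_inv_of_zero_notMem {U : Set E} (hU : IsOpen U) (h0 : (0 : E) ∉ U) :
    IsOpen U⁻¹ := by
  refine isOpen_iff_mem_nhds.2 fun x hx => ?_
  have hx0 : x ≠ 0 := by
    rintro rfl
    rw [Set.mem_inv, inv_zero] at hx
    exact h0 hx
  exact continuousAt_inv₀ hx0 (hU.mem_nhds hx)

variable [MeasurableSpace E] [BorelSpace E]

theorem measurable_rho (n : ℕ) : Measurable (rho p F E n) := by
  classical
  refine Measurable.ite (measurableSet_le measurable_norm measurable_const) (measurable_rhoInt n) ?_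
  exact (((continuous_modulus p F).measurable.pow_const 2).inv.real_toNNReal).mul
    ((measurable_rhoInt n).comp measurable_inv)

theorem lintegral_rootCount_of_norm_le {n : ℕ} (hn : 1 ≤ n) {U : Set E} (hUo : IsOpen U)
    (hU1 : ∀ x ∈ U, ‖x‖ ≤ 1) (hU : ∀ x ∈ U, powDiscr F E x ≠ 0) :
    ∫⁻ P : Omega p F n, rootCount U P ∂(polyMeasure p F n) =
      ∫⁻ x in U, rhoInt p F E n x ∂(haar p F E) := by
  rcases le_or_gt (Module.finrank F E) n with h | h
  · exact lintegral_rootCount_integral hn h hUo hU1 hU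
  · rw [lintegral_rootCount_eq_zero hn h hU]
    have : ∀ x : E, rhoInt p F E n x = 0 := fun x => rhoInt_eq_zero fun h' => h.not_ge h'.2.2
    simp [this]

/-- The roots of the reversed polynomial are the inverses of those of `P`, away from `0`, and
reversal preserves the distribution. The question moves to `U⁻¹`, inside the unit ball; pulling the
integral back along inversion produces the factor in `rho`. -/
theorem lintegral_rootCount_of_lt_norm {n : ℕ} (hn : 1 ≤ n) {U : Set E} (hUo : IsOpen U)
    (hU1 : ∀ x ∈ U, 1 < ‖x‖) (hU : ∀ x ∈ U, powDiscr F E x ≠ 0) :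
    ∫⁻ P : Omega p F n, rootCount U P ∂(polyMeasure p F n) =
      ∫⁻ x in U, rho p F E n x ∂(haar p F E) := by
  have h0 : (0 : E) ∉ U := fun h => by
    have := hU1 0 h
    rw [norm_zero] at this
    linarith
  have hUi := isOpen_inv_of_zero_notMem hUo h0
  have hrev : Measurable fun (a : Omega p F n) (i : Fin (n + 1)) => a i.rev :=
    measurable_pi_lambda _ fun i => measurable_pi_apply _
  calc ∫⁻ P : Omega p F n, rootCount U P ∂(polyMeasure p F n)
      = ∫⁻ P : Omega p F n, rootCount U⁻¹ (fun i => P i.rev) ∂(polyMeasure p F n) := by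
        simp only [rootCount_inv h0]
    _ = ∫⁻ P : Omega p F n, rootCount U⁻¹ P ∂(polyMeasure p F n) := by
        rw [← lintegral_map (measurable_rootCount hUi n) hrev, map_reverse_polyMeasure]
    _ = ∫⁻ x in U⁻¹, rhoInt p F E n x ∂(haar p F E) := by
        refine lintegral_rootCount_of_norm_le hn hUi (fun x hx => ?_) fun x hx => ?_
        · have := hU1 _ hx
          rw [norm_inv] at this
          exact ((one_lt_inv_iff₀.1 this).2).le
        · have := powDiscr_ne_zero_iff (p := p).1 (hU _ hx)
          exact powDiscr_ne_zero_iff (p := p).2 ((adjoin_singleton_inv_eq_top_iff x).1 this)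
    _ = ∫⁻ x, ENNReal.ofReal (modulus p F E x ^ 2)⁻¹ *
          U⁻¹.indicator (fun y => (rhoInt p F E n y : ℝ≥0∞)) x⁻¹ ∂(haar p F E) := by
        rw [← lintegral_indicator hUi.measurableSet, lintegral_haar_inv]
        exact (measurable_rhoInt n).coe_nnreal_ennreal.indicator hUi.measurableSet
    _ = ∫⁻ x, U.indicator (fun y => (rho p F E n y : ℝ≥0∞)) x ∂(haar p F E) := by
        refine lintegral_congr fun x => ?_
        by_cases hx : x ∈ U
        · rw [Set.indicator_of_mem hx, Set.indicator_of_mem (by simpa using hx),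
            rho_of_lt_norm (hU1 x hx), ENNReal.coe_mul]
          rfl
        · rw [Set.indicator_of_notMem hx, Set.indicator_of_notMem (by simpa using hx), mul_zero]
    _ = ∫⁻ x in U, rho p F E n x ∂(haar p F E) := lintegral_indicator hUo.measurableSet _

/-- The expected number of roots generating `E` in an open subset of `E`. -/
theorem lintegral_rootCount_powDiscr_ne_zero {n : ℕ} (hn : 1 ≤ n) {U : Set E} (hUo : IsOpen U) :
    ∫⁻ P : Omega p F n, rootCount (U ∩ {x | powDiscr F E x ≠ 0}) P ∂(polyMeasure p F n) =
      ∫⁻ x in U, rho p F E n x ∂(haar p F E) := by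
  haveI := isUltrametricDist_ext p F E
  set W : Set E := U ∩ {x | powDiscr F E x ≠ 0}
  have hWo : IsOpen W := hUo.inter (isOpen_ne_fun (continuous_powDiscr p F E) continuous_const)
  let A : Set E := W ∩ {x | ‖x‖ ≤ 1}
  let B : Set E := W ∩ {x | 1 < ‖x‖}
  have hAo : IsOpen A := by
    have h := IsUltrametricDist.isOpen_closedBall (0 : E) one_ne_zero
    have h' : Metric.closedBall (0 : E) 1 = {x | ‖x‖ ≤ 1} := by
      ext
      simp
    exact hWo.inter (h' ▸ h)
  have hBo : IsOpen B := hWo.inter (isOpen_lt continuous_const continuous_norm)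
  have hAB : W = A ∪ B := by
    ext x
    simp only [A, B, Set.mem_union, Set.mem_inter_iff, Set.mem_ofPred_eq]
    have := le_or_gt ‖x‖ 1
    tauto
  have hd : Disjoint A B := Set.disjoint_left.2 fun x hx hx' =>
    not_lt_of_ge (show ‖x‖ ≤ 1 from hx.2) hx'.2
  -- Discarding the points that do not generate `E` costs nothing, since the density vanishes there.
  have hW : ∫⁻ x in U, rho p F E n x ∂(haar p F E) = ∫⁻ x in W, rho p F E n x ∂(haar p F E) := by
    rw [← lintegral_indicator hUo.measurableSet, ← lintegral_indicator hWo.measurableSet]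
    refine lintegral_congr fun x => ?_
    by_cases hx : powDiscr F E x = 0
    · have h0 : rho p F E n x = 0 := rho_eq_zero fun h => powDiscr_ne_zero_iff (p := p).2 h hx
      simp [Set.indicator, h0]
    · have hm : x ∈ W ↔ x ∈ U := ⟨fun h => h.1, fun h => ⟨h, hx⟩⟩
      by_cases hU : x ∈ U
      · rw [Set.indicator_of_mem hU, Set.indicator_of_mem (hm.2 hU)]
      · rw [Set.indicator_of_notMem hU, Set.indicator_of_notMem fun h => hU (hm.1 h)]
  have h1 : ∫⁻ x in A, rho p F E n x ∂(haar p F E) = ∫⁻ x in A, rhoInt p F E n x ∂(haar p F E) :=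
    setLIntegral_congr_fun hAo.measurableSet fun x hx => by rw [rho_of_norm_le hx.2]
  rw [hW, hAB, lintegral_union hBo.measurableSet hd, h1,
    ← lintegral_rootCount_of_norm_le hn hAo (fun x hx => hx.2) (fun x hx => hx.1.2),
    ← lintegral_rootCount_of_lt_norm hn hBo (fun x hx => hx.2) (fun x hx => hx.1.2),
    ← lintegral_add_left (measurable_rootCount hAo n)]
  simp only [rootCount_union hd]

end Density

/-! ### New roots and the sum over subextensions. -/

theorem encard_eq_tsum_fiber {α ι : Type*} (S : Set α) (f : α → ι) :
    (S.encard : ℝ≥0∞) = ∑' i, ({x | x ∈ S ∧ f x = i}.encard : ℝ≥0∞) := by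
  rw [← ENNReal.tsum_set_one, ← (Equiv.sigmaFiberEquiv fun x : S => f x).tsum_eq,
    ENNReal.tsum_sigma' (f := fun _ => (1 : ℝ≥0∞))]
  refine tsum_congr fun i => ?_
  rw [← ENNReal.tsum_set_one]
  exact (Equiv.subtypeSubtypeEquivSubtypeInter (fun x => x ∈ S) (fun x => f x = i)).tsum_eq
    (fun _ => (1 : ℝ≥0∞))

/-- A consequence of the primitive element theorem; it supplies the countability that allows
exchanging the sum over subextensions with the expectation. -/
theorem finite_Iic_intermediateField {F L : Type*} [Field F] [Field L] [Algebra F L] [CharZero F]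
    (K : IntermediateField F L) [FiniteDimensional F K] : Finite (Set.Iic K) := by
  haveI : Finite (IntermediateField F K) :=
    Field.finite_intermediateField_of_exists_primitive_element F K
      (Field.exists_primitive_element F K)
  refine Finite.of_injective (fun K' : Set.Iic K => IntermediateField.restrict K'.2) ?_
  intro K₁ K₂ h
  exact Subtype.ext <| (IntermediateField.lift_restrict K₁.2).symm.trans <|
    (congrArg IntermediateField.lift h).trans (IntermediateField.lift_restrict K₂.2)

section Subfields

variable {p : ℕ} [Fact p.Prime] {F : Type*} [NormedField F] [NormedAlgebra ℚ_[p] F]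
  {Fbar : Type*} [NormedField Fbar] [NormedAlgebra F Fbar]

theorem isNew_iff {K : IntermediateField F Fbar} (x : K) :
    IsNew K (x : Fbar) ↔ IntermediateField.adjoin F {(x : Fbar)} = K := by
  constructor
  · rintro ⟨hx, h⟩
    by_contra hne
    exact h _ (lt_of_le_of_ne (IntermediateField.adjoin_simple_le_iff.2 hx) hne)
      (IntermediateField.mem_adjoin_simple_self F _)
  · intro h
    refine ⟨x.2, fun K' hK' hx => ?_⟩
    exact hK'.not_ge (h ▸ IntermediateField.adjoin_simple_le_iff.2 hx)

theorem adjoin_coe_eq_iff {K : IntermediateField F Fbar} [FiniteDimensional F K] (x : K) :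
    IntermediateField.adjoin F {(x : Fbar)} = K ↔ Algebra.adjoin F {x} = ⊤ := by
  rw [adjoin_singleton_eq_top_iff, ← IntermediateField.lift_inj, IntermediateField.lift_top,
    IntermediateField.lift_adjoin_simple]

theorem Z_eq_rootCount {K : IntermediateField F Fbar} (U : Set K) (n : ℕ) :
    Z p U n = rootCount U := by
  funext P
  simp only [Z, rootCount, aeval_toPoly]

theorem Znew_eq_rootCount {K : IntermediateField F Fbar} [FiniteDimensional F K] (U : Set K)
    (n : ℕ) : Znew p U n = rootCount (U ∩ {x | powDiscr F K x ≠ 0}) := by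
  funext P
  simp only [Znew, rootCount, aeval_toPoly, isNew_iff, adjoin_coe_eq_iff,
    ← powDiscr_ne_zero_iff (p := p), Set.mem_inter_iff, Set.mem_ofPred_eq, and_assoc]

/-- Sort the roots `x` by the field `F(x)` they generate: this is the only subextension in which `x`
is new. -/
theorem Z_eq_tsum {K : IntermediateField F Fbar} [FiniteDimensional F K] (U : Set K) (n : ℕ)
    (P : Omega p F n) :
    Z p U n P = ∑' K' : Set.Iic K, Znew p (IntermediateField.inclusion K'.2 ⁻¹' U) n P := by
  rw [Z, encard_eq_tsum_fiber _ fun x : K => (⟨IntermediateField.adjoin F {(x : Fbar)},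
    IntermediateField.adjoin_simple_le_iff.2 x.2⟩ : Set.Iic K)]
  refine tsum_congr fun K' => ?_
  rw [Znew, ← (IntermediateField.inclusion_injective K'.2).encard_image]
  congr 2
  ext x
  simp only [Set.mem_ofPred_eq, Set.mem_image, Set.mem_preimage, isNew_iff]
  constructor
  · rintro ⟨⟨hx, h0⟩, hK'⟩
    have hK : IntermediateField.adjoin F {(x : Fbar)} = K' := congrArg Subtype.val hK'
    have hxK : (x : Fbar) ∈ (K' : IntermediateField F Fbar) :=
      hK ▸ IntermediateField.mem_adjoin_simple_self F _
    have hi : IntermediateField.inclusion K'.2 ⟨x, hxK⟩ = x := rfl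
    refine ⟨⟨x, hxK⟩, ⟨by rwa [hi], hK, ?_⟩, hi⟩
    apply IntermediateField.inclusion_injective K'.2
    rw [← aeval_algHom_apply, hi, h0, map_zero]
  · rintro ⟨y, ⟨hy, hK, h0⟩, rfl⟩
    refine ⟨⟨hy, ?_⟩, Subtype.ext hK⟩
    rw [aeval_algHom_apply, h0, map_zero]

end Subfields
end PadicRoots

/-! ### Assembly of the theorem. -/

theorem theoremA (p : ℕ) [Fact p.Prime]
    (F : Type*) [NormedField F] [NormedAlgebra ℚ_[p] F] [FiniteDimensional ℚ_[p] F]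
    [MeasurableSpace F] [BorelSpace F]
    (Fbar : Type*) [NormedField Fbar] [NormedAlgebra F Fbar] [IsAlgClosure F Fbar]
    [MeasurableSpace Fbar] [BorelSpace Fbar] :
    ∃ ρ : (K : IntermediateField F Fbar) → ℕ → K → ℝ≥0,
      ∀ (K : IntermediateField F Fbar) [FiniteDimensional F K] (n : ℕ), 1 ≤ n →
        -- the explicit form of the density functions
        (∀ x : K, ‖x‖ ≤ 1 → Algebra.adjoin F {x} = ⊤ → Module.finrank F K ≤ n →
          (ρ K n x : ℝ) = pnorm p F (discr p F K) / (intIndex p F K x : ℝ) *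
            ∫ Q : Omega p F (n - Module.finrank F K),
              pnorm p F (aeval x (toPoly p F Q)) ^ Module.finrank F K
              ∂(polyMeasure p F (n - Module.finrank F K))) ∧
        (∀ x : K, ‖x‖ ≤ 1 → ¬ (Algebra.adjoin F {x} = ⊤ ∧ Module.finrank F K ≤ n) →
          ρ K n x = 0) ∧
        (∀ x : K, 1 < ‖x‖ →
          (ρ K n x : ℝ) = (pnorm p F x ^ (2 * Module.finrank F K))⁻¹ * ρ K n x⁻¹) ∧
        Measurable (ρ K n) ∧
        -- the expected number of roots, and of new roots, in an open subset of `K`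
        ∀ U : Set K, IsOpen U →
          Measurable (Z p U n) ∧ Measurable (Znew p U n) ∧
          ∫⁻ P, Z p U n P ∂(polyMeasure p F n) ≠ ∞ ∧
          ∫⁻ P, Znew p U n P ∂(polyMeasure p F n) = ∫⁻ x in U, ρ K n x ∂(haar p F K) ∧
          ∫⁻ P, Z p U n P ∂(polyMeasure p F n) =
            ∑' K' : Set.Iic K, ∫⁻ x in IntermediateField.inclusion K'.2 ⁻¹' U,
              ρ K' n x ∂(haar p F (K' : IntermediateField F Fbar)) := by
  classical
  haveI := charZero_base p F
  refine ⟨fun K n x => if _ : FiniteDimensional F K then rho p F K n x else 0, ?_⟩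
  intro K hK n hn
  have hρ : ∀ (K' : IntermediateField F Fbar) [h : FiniteDimensional F K'] (x : K'),
      (if _ : FiniteDimensional F K' then rho p F K' n x else 0) = rho p F K' n x :=
    fun K' h x => dif_pos h
  simp only [hρ]
  have hnew : ∀ (K' : IntermediateField F Fbar) [FiniteDimensional F K'] (V : Set K'), IsOpen V →
      Measurable (Znew p V n) ∧
      ∫⁻ P, Znew p V n P ∂(polyMeasure p F n) = ∫⁻ x in V, rho p F K' n x ∂(haar p F K') := by
    intro K' _ V hV
    rw [Znew_eq_rootCount]
    exact ⟨measurable_rootCount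
      (hV.inter (isOpen_ne_fun (continuous_powDiscr p F K') continuous_const)) n,
      lintegral_rootCount_powDiscr_ne_zero hn hV⟩
  refine ⟨fun x hx hx1 hr => ?_, fun x hx hx1 => ?_, fun x hx => ?_, ?_, fun U hU => ?_⟩
  · rw [rho_of_norm_le hx, rhoInt_of_mem hx hx1 hr, Real.coe_toNNReal _ (intDensity_nonneg n x)]
    rfl
  · rw [rho_of_norm_le hx, rhoInt_eq_zero fun h => hx1 h.2]
  · have hx' : ‖x⁻¹‖ ≤ 1 := by
      rw [norm_inv]
      exact inv_le_one_of_one_le₀ hx.le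
    rw [rho_of_lt_norm hx, rho_of_norm_le hx', NNReal.coe_mul, Real.coe_toNNReal _
      (inv_nonneg.2 (sq_nonneg _)), modulus, ← pow_mul, mul_comm 2]
  · exact measurable_rho n
  · refine ⟨?_, (hnew K U hU).1, ?_, (hnew K U hU).2, ?_⟩
    · rw [Z_eq_rootCount]
      exact measurable_rootCount hU n
    · rw [Z_eq_rootCount]
      exact ne_top_of_le_ne_top (ENNReal.natCast_ne_top n) (lintegral_rootCount_le hn U)
    · haveI := finite_Iic_intermediateField K
      have hcont : ∀ K' : Set.Iic K, Continuous (IntermediateField.inclusion K'.2) := fun K' =>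
        continuous_subtype_val.subtype_mk _
      simp only [Z_eq_tsum]
      rw [lintegral_tsum fun K' => (hnew K' _ (hU.preimage (hcont K'))).1.aemeasurable]
      exact tsum_congr fun K' => (hnew K' _ (hU.preimage (hcont K'))).2
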